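/- Let $\mathcal X,\mathcal Y$ be real Hilbert spaces, $f:\mathcal X\to\mathbb R$ convex and continuously differentiable, $A:\mathcal X\to\mathcal Y$ a bounded linear operator and $b\in\mathcal Y$. Put $\mathcal L(x,\lambda)=f(x)+\langle\lambda,Ax-b\rangle$ and, for $c>0$, $p>0$, $t>0$, $\mathcal L_t(x,\lambda)=\mathcal L(x,\lambda)+\frac{c}{2t^p}(\|x\|^2-\|\lambda\|^2)$. Let $\Omega$ be the set of saddle points of $\mathcal L$, assumed non-empty, let $(x^*,\lambda^*)=\mathrm{Proj}_\Omega 0$ be its element of minimal norm in the Hilbert product $\mathcal X\times\mathcal Y$, and let $(x_t,\lambda_t)$ be the saddle point of $\mathcal L_t$. Let $t_0>0$, $\alpha>1$, $0<q<1$, $\gamma>0$, $s>0$, and let $m:[t_0,+\infty)\to(0,+\infty)$ be differentiable and non-increasing. Suppose that there are $k_1,k_2>0$ such that, for all large $t$, $\frac{\gamma}{t^{q+s}}\le m(t)\le\frac{k_1}{t^q}$, $m$ is twice differentiable at $t$, $t|\dot m(t)|\le k_2m(t)$ and $t^2|\ddot m(t)|\le k_2m(t)$. Let $(x,\lambda):[t_0,+\infty)\to\mathcal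 X\times\mathcal Y$ be a global solution ($x$ twice differentiable, $\lambda$ and $t\mapsto\nabla_x\mathcal L_t(x(t),\lambda(t))$ differentiable) of $$\begin{cases} m(t)\ddot x(t)+\frac{\alpha}{t^q}\dot x(t)+\gamma\frac{d}{dt}\nabla_x\mathcal L_t(x(t),\lambda(t))+t^s\nabla_x\mathcal L_t(x(t),\lambda(t))=0,\\ \dot\lambda(t)-(\alpha-1)(t^{q+s}-\gamma qt^{q-1})\nabla_\lambda\mathcal L_t(x(t)+\theta(t)\dot x(t),\lambda(t))=0,\end{cases}$$ where $$\theta(t)=\frac{m(t)t^{2q+s}+\gamma t^q-2m(t)\gamma qt^{2q-1}-\gamma\dot m(t)t^{2q}}{(\alpha-1)(t^{q+s}-\gamma qt^{q-1})}.$$ Suppose that $\frac{1-q}{2}\le p<1-q$, $\frac{1-q}{2}\le 2q+s<1-q$ and $4q+s+p-2<0$. Then: (i) $\lim_{t\to+\infty}\|(x(t),\lambda(t))-(x^*,\lambda^*)\|=0$. (ii) If $p<2q+s$, then, as $t\to+\infty$, the quantities $\mathcal L(x(t),\lambda^*)-\mathcal L(x^*,\lambda^*)$, $|f(x(t))-f(x^*)|$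 and $\|Ax(t)-b\|$ are all $\mathcal O\big(\sqrt{m(t)}\,t^{\frac{4q+s+p-2}{2}}+\frac1{t^p}\big)$, and $\|(x(t)-x_t,\lambda(t)-\lambda_t)\|^2=\mathcal O\big(m(t)t^{4q+s+p-2}\big)$. (iii) If $2q+s\le p$, then, as $t\to+\infty$, the quantities $\mathcal L(x(t),\lambda^*)-\mathcal L(x^*,\lambda^*)$, $|f(x(t))-f(x^*)|$ and $\|Ax(t)-b\|$ are all $\mathcal O\big(\sqrt{m(t)}\,t^{q+p-1}+\frac1{t^p}\big)$, and $\|(x(t)-x_t,\lambda(t)-\lambda_t)\|^2=\mathcal O\big(m(t)t^{2q+2p-2}\big)$. -/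

import Mathlib

open Set Filter Topology Asymptotics

noncomputable section

namespace PrimalDual

variable {X Y : Type*}
  [NormedAddCommGroup X] [InnerProductSpace ℝ X]
  [NormedAddCommGroup Y] [InnerProductSpace ℝ Y]

/-- `(x₀, l₀)` is a saddle point of `K : X × Y → ℝ` (minimisation in `x`, maximisation in `l`). -/
def IsSaddlePt (K : X → Y → ℝ) (x₀ : X) (l₀ : Y) : Prop :=
  ∀ (x : X) (l : Y), K x₀ l ≤ K x₀ l₀ ∧ K x₀ l₀ ≤ K x l₀

/-- The Lagrangian `f x + ⟨l, A x - b⟩` of the problem `min f x` subject to `A x = b`. -/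
def lagrangian (f : X → ℝ) (A : X →L[ℝ] Y) (b : Y) (x : X) (l : Y) : ℝ :=
  f x + inner ℝ l (A x - b)

/-- The regularised Lagrangian
`f x + ⟨l, A x - b⟩ + c / (2 t ^ p) * (‖x‖ ^ 2 - ‖l‖ ^ 2)`. -/
def regLagrangian (f : X → ℝ) (A : X →L[ℝ] Y) (b : Y) (c p t : ℝ) (x : X) (l : Y) : ℝ :=
  lagrangian f A b x l + c / (2 * t ^ p) * (‖x‖ ^ 2 - ‖l‖ ^ 2)

/-- The partial gradient of the regularised Lagrangian in the primal variable. -/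
def gradPrimal [CompleteSpace X] (f : X → ℝ) (A : X →L[ℝ] Y) (b : Y) (c p t : ℝ)
    (x : X) (l : Y) : X :=
  gradient (fun x' => regLagrangian f A b c p t x' l) x

/-- The partial gradient of the regularised Lagrangian in the dual variable. -/
def gradDual [CompleteSpace Y] (f : X → ℝ) (A : X →L[ℝ] Y) (b : Y) (c p t : ℝ)
    (x : X) (l : Y) : Y :=
  gradient (fun l' => regLagrangian f A b c p t x l') l

/-- The norm of the Hilbert product `X × Y`, that is `√(‖x‖ ^ 2 + ‖l‖ ^ 2)`. -/
def pairNorm (x : X) (l : Y) : ℝ := ‖WithLp.toLp 2 (x, l)‖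

/-- `(x₀, l₀)` is the projection of the origin onto the set of saddle points of the Lagrangian,
i.e. the saddle point of minimal norm. -/
def IsMinNormSaddlePt (f : X → ℝ) (A : X →L[ℝ] Y) (b : Y) (x₀ : X) (l₀ : Y) : Prop :=
  IsSaddlePt (lagrangian f A b) x₀ l₀ ∧
    ∀ (x : X) (l : Y), IsSaddlePt (lagrangian f A b) x l → pairNorm x₀ l₀ ≤ pairNorm x l

/-- The time derivative of a function on the half-line `[t₀, ∞)` (one-sided at `t₀`). -/
def tderiv {E : Type*} [NormedAddCommGroup E] [NormedSpace ℝ E] (t₀ : ℝ) (u : ℝ → E) : ℝ → E :=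
  derivWithin u (Ici t₀)

/-- The extrapolation parameter `θ`. -/
def extrap (α γ q s t₀ : ℝ) (m : ℝ → ℝ) (t : ℝ) : ℝ :=
  (m t * t ^ (2 * q + s) + γ * t ^ q - 2 * m t * γ * q * t ^ (2 * q - 1)
      - γ * tderiv t₀ m t * t ^ (2 * q)) /
    ((α - 1) * (t ^ (q + s) - γ * q * t ^ (q - 1)))

/-- `m` is an admissible mass function on `[t₀, ∞)`: positive, differentiable, nonincreasing. -/
structure IsMass (t₀ : ℝ) (m : ℝ → ℝ) : Prop where
  pos : ∀ t ∈ Ici t₀, 0 < m t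
  diff : DifferentiableOn ℝ m (Ici t₀)
  anti : AntitoneOn m (Ici t₀)

/-- For some `k₁ > 0`, `γ / t ^ (q + s) ≤ m t ≤ k₁ / t ^ q` for all large `t`. -/
def MassBounds (γ q s : ℝ) (m : ℝ → ℝ) : Prop :=
  ∃ k₁ : ℝ, 0 < k₁ ∧ ∀ᶠ t in atTop, γ / t ^ (q + s) ≤ m t ∧ m t ≤ k₁ / t ^ q

/-- For some `k₂ > 0` and all large `t`, the mass is twice differentiable at `t`,
`t |m'| ≤ k₂ m` and `t ^ 2 |m''| ≤ k₂ m`. -/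
def MassDerivBounds (t₀ : ℝ) (m : ℝ → ℝ) : Prop :=
  ∃ k₂ : ℝ, 0 < k₂ ∧ ∀ᶠ t in atTop,
    DifferentiableWithinAt ℝ (tderiv t₀ m) (Ici t₀) t ∧
    t * |tderiv t₀ m t| ≤ k₂ * m t ∧
    t ^ 2 * |tderiv t₀ (tderiv t₀ m) t| ≤ k₂ * m t

/-- `(x, l)` is a (classical) global solution on `[t₀, ∞)` of the primal-dual system with variable
mass `m`, viscous damping `α / t ^ q`, Hessian-driven damping `γ` and time scaling `t ^ s`. -/
structure IsGlobalSolution [CompleteSpace X] [CompleteSpace Y]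
    (f : X → ℝ) (A : X →L[ℝ] Y) (b : Y) (α γ c p q s t₀ : ℝ) (m : ℝ → ℝ)
    (x : ℝ → X) (l : ℝ → Y) : Prop where
  diff_x : DifferentiableOn ℝ x (Ici t₀)
  diff_dx : DifferentiableOn ℝ (tderiv t₀ x) (Ici t₀)
  diff_l : DifferentiableOn ℝ l (Ici t₀)
  diff_grad : DifferentiableOn ℝ (fun τ => gradPrimal f A b c p τ (x τ) (l τ)) (Ici t₀)
  primal_eq : ∀ t ∈ Ici t₀,
    m t • tderiv t₀ (tderiv t₀ x) t + (α / t ^ q) • tderiv t₀ x t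
      + γ • tderiv t₀ (fun τ => gradPrimal f A b c p τ (x τ) (l τ)) t
      + t ^ s • gradPrimal f A b c p t (x t) (l t) = 0
  dual_eq : ∀ t ∈ Ici t₀,
    tderiv t₀ l t - ((α - 1) * (t ^ (q + s) - γ * q * t ^ (q - 1))) •
      gradDual f A b c p t (x t + extrap α γ q s t₀ m t • tderiv t₀ x t) (l t) = 0

/-- The primal-dual gap, the objective residual and the feasibility violation along `(x, l)` are
`O(√(m t) t ^ e + t ^ (-p))` and the squared distance to `(xt, lt)` is `O(m t * t ^ (2 e))`. -/
structure HasRates (f : X → ℝ) (A : X →L[ℝ] Y) (b : Y) (p e : ℝ) (m : ℝ → ℝ)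
    (x : ℝ → X) (l : ℝ → Y) (xt : ℝ → X) (lt : ℝ → Y) (xs : X) (ls : Y) : Prop where
  gap : (fun t => lagrangian f A b (x t) ls - lagrangian f A b xs ls)
    =O[atTop] fun t => √(m t) * t ^ e + 1 / t ^ p
  objective : (fun t => |f (x t) - f xs|) =O[atTop] fun t => √(m t) * t ^ e + 1 / t ^ p
  feasibility : (fun t => ‖A (x t) - b‖) =O[atTop] fun t => √(m t) * t ^ e + 1 / t ^ p
  dist_sq : (fun t => pairNorm (x t - xt t) (l t - lt t) ^ 2)
    =O[atTop] fun t => m t * t ^ (2 * e)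

end PrimalDual

end

namespace PrimalDual

/-! Write a = α − 1, ε(t) = c / t^p, w_t = (x_t, λ_t) and W = ‖(x*, λ*)‖. The trajectory is compared
with the moving target w_t rather than with its limit. The saddle operator of the Lagrangian is
monotone, which yields one inequality between saddle points of different weights
(`IsSaddlePt.inner_le_zero`). It gives both w_t → (x*, λ*) (`tendsto_saddle`) and ‖w_z − w_t‖ ≤
((z/t)^p − 1) W for z ≥ t (`pairNorm_curve_sub_le`), so the target moves with speed at most pW/t.

Let g be the primal gradient and V = t^q (m ẋ + γ g). The primal equation becomes V̇ = −(r + a) ẋ −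
β g with r = `crossCoef` and β = `dualScale`, and θ = δ / (aβ) with δ = `gapWeight`. With these
weights the cross terms in the derivative of E = δ · gap + ½‖a(x − x_t) + V‖² + (ra/2)‖x − x_t‖² +
½‖λ − λ_t‖² cancel (`dini_lyapunov_le`). Since w_t is only known to be locally Lipschitz, E is
majorised to the right of each time by a differentiable function touching it there, which bounds its
upper right Dini derivative (`eventually_slope_lyapunov_lt`).

The regularisation leaves a dissipation of order βε ~ t^(q+s−p) on the squared distances. Young's
inequality absorbs the drift of w_t (`absorption`, `residual_le`), so that D⁺E ≤ −a₀ t^(−κ) E + K m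
t^(3q+s+p−2) at large times, for any κ in [0, 1) with κ ≥ p − q − s. As κ < 1, the contraction is
faster than any polynomial decay, whence E = O(m t^(3q+s+p−2+κ)) (`exists_le_mul_of_dini`). The
choices κ = q and κ = p − q − s give the exponents of (ii) and (iii).

Finally E dominates the squared distance to w_t, the residuals at w_t are O(t^(−p)), and local
Lipschitz continuity of f and A transfers the rates to x (`tendsto_and_hasRates`). -/

lemma pairNorm_sq {X Y : Type*} [NormedAddCommGroup X] [InnerProductSpace ℝ X]
    [NormedAddCommGroup Y] [InnerProductSpace ℝ Y] (x : X) (l : Y) :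
    pairNorm x l ^ 2 = ‖x‖ ^ 2 + ‖l‖ ^ 2 := by
  rw [pairNorm, WithLp.prod_norm_sq_eq_of_L2, WithLp.toLp_fst, WithLp.toLp_snd]

lemma pairNorm_nonneg {X Y : Type*} [NormedAddCommGroup X] [InnerProductSpace ℝ X]
    [NormedAddCommGroup Y] [InnerProductSpace ℝ Y] (x : X) (l : Y) : 0 ≤ pairNorm x l :=
  norm_nonneg _

/-- The gradient inequality for a differentiable convex function. -/
lemma gradient_le_of_convex {X : Type*} [NormedAddCommGroup X] [InnerProductSpace ℝ X]
    [CompleteSpace X] {f : X → ℝ} (hf : Differentiable ℝ f) (hconv : ConvexOn ℝ univ f) (x y : X) :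
    f x + inner ℝ (gradient f x) (y - x) ≤ f y := by
  have hline : HasDerivAt (fun t : ℝ => x + t • (y - x)) (y - x) 0 := by
    simpa using ((hasDerivAt_id (0 : ℝ)).smul_const (y - x)).const_add x
  have hd : HasDerivAt (fun t : ℝ => f (x + t • (y - x))) (inner ℝ (gradient f x) (y - x)) 0 := by
    have h1 : HasFDerivAt f (fderiv ℝ f x) (x + (0 : ℝ) • (y - x)) := by
      simpa using (hf x).hasFDerivAt
    have h2 := h1.comp_hasDerivAt (0 : ℝ) hline
    rw [inner_gradient_left]
    exact h2
  have hc : ConvexOn ℝ univ (fun t : ℝ => f (x + t • (y - x))) := by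
    have h := hconv.comp_affineMap (AffineMap.lineMap x y : ℝ →ᵃ[ℝ] X)
    have e : (fun t : ℝ => f (x + t • (y - x))) = f ∘ (AffineMap.lineMap x y : ℝ →ᵃ[ℝ] X) := by
      ext t
      simp [AffineMap.lineMap_apply, add_comm]
    rw [e]
    simpa using h
  have h := hc.le_slope_of_hasDerivAt (mem_univ 0) (mem_univ 1) zero_lt_one hd
  simp only [slope_def_field, one_smul, zero_smul, add_zero, add_sub_cancel, sub_zero, div_one] at h
  linarith

/-! ### First-order conditions and monotonicity for regularised saddle points. -/

section FirstOrder

variable {X Y : Type*} [NormedAddCommGroup X] [InnerProductSpace ℝ X]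
  [NormedAddCommGroup Y] [InnerProductSpace ℝ Y]

/-- The Lagrangian with a Tikhonov term of weight `ε / 2`. -/
noncomputable def tikhonov (f : X → ℝ) (A : X →L[ℝ] Y) (b : Y) (ε : ℝ) (x : X) (l : Y) : ℝ :=
  f x + inner ℝ l (A x - b) + ε / 2 * (‖x‖ ^ 2 - ‖l‖ ^ 2)

lemma lagrangian_eq_tikhonov (f : X → ℝ) (A : X →L[ℝ] Y) (b : Y) :
    lagrangian f A b = tikhonov f A b 0 := by
  ext x l
  simp [lagrangian, tikhonov]

lemma regLagrangian_eq_tikhonov (f : X → ℝ) (A : X →L[ℝ] Y) (b : Y) (c p t : ℝ) :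
    regLagrangian f A b c p t = tikhonov f A b (c / t ^ p) := by
  ext x l
  simp only [regLagrangian, lagrangian, tikhonov]
  rw [div_div, mul_comm (t ^ p) 2]

variable [CompleteSpace Y]

lemma hasGradientAt_tikhonov_dual (f : X → ℝ) (A : X →L[ℝ] Y) (b : Y)
    (ε : ℝ) (x : X) (l : Y) :
    HasGradientAt (fun l' => tikhonov f A b ε x l') (A x - b - ε • l) l := by
  rw [hasGradientAt_iff_hasFDerivAt]
  have h2 : HasFDerivAt (fun l' => f x + (inner ℝ l' (A x - b) : ℝ)) (innerSL ℝ (A x - b)) l := by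
    refine ((innerSL ℝ (A x - b)).hasFDerivAt.const_add (f x)).congr_of_eventuallyEq ?_
    exact Eventually.of_forall fun l' => by simp only [innerSL_apply_apply, real_inner_comm l']
  have h3 : HasFDerivAt (fun l' : Y => ‖x‖ ^ 2 - ‖l'‖ ^ 2) (-(2 • (innerSL ℝ l))) l :=
    (hasStrictFDerivAt_norm_sq l).hasFDerivAt.const_sub _
  refine (h2.add (h3.const_mul (ε / 2))).congr_fderiv ?_
  ext y
  simp
  ring

variable [CompleteSpace X]

lemma hasGradientAt_tikhonov_primal {f : X → ℝ} (hf : Differentiable ℝ f) (A : X →L[ℝ] Y) (b : Y)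
    (ε : ℝ) (x : X) (l : Y) :
    HasGradientAt (fun x' => tikhonov f A b ε x' l)
      (gradient f x + ContinuousLinearMap.adjoint A l + ε • x) x := by
  rw [hasGradientAt_iff_hasFDerivAt]
  have h1 := (hf x).hasFDerivAt
  have h2 : HasFDerivAt (fun x' => (inner ℝ l (A x' - b) : ℝ)) ((innerSL ℝ l).comp A) x := by
    exact ((innerSL ℝ l).hasFDerivAt).comp x (A.hasFDerivAt.sub_const b)
  have h3 : HasFDerivAt (fun x' : X => ‖x'‖ ^ 2 - ‖l‖ ^ 2) (2 • (innerSL ℝ x)) x :=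
    (hasStrictFDerivAt_norm_sq x).hasFDerivAt.sub_const _
  refine ((h1.add h2).add (h3.const_mul (ε / 2))).congr_fderiv ?_
  ext y
  simp [ContinuousLinearMap.adjoint_inner_left]
  ring

lemma gradPrimal_eq {f : X → ℝ} (hf : Differentiable ℝ f) (A : X →L[ℝ] Y) (b : Y)
    (c p t : ℝ) (x : X) (l : Y) :
    gradPrimal f A b c p t x l
      = gradient f x + ContinuousLinearMap.adjoint A l + (c / t ^ p) • x := by
  rw [gradPrimal, regLagrangian_eq_tikhonov]
  exact (hasGradientAt_tikhonov_primal hf A b _ x l).gradient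

lemma gradDual_eq (f : X → ℝ) (A : X →L[ℝ] Y) (b : Y) (c p t : ℝ) (x : X) (l : Y) :
    gradDual f A b c p t x l = A x - b - (c / t ^ p) • l := by
  rw [gradDual, regLagrangian_eq_tikhonov]
  exact (hasGradientAt_tikhonov_dual f A b _ x l).gradient

lemma IsSaddlePt.gradient_eq_zero {f : X → ℝ} (hf : Differentiable ℝ f) {A : X →L[ℝ] Y} {b : Y}
    {ε : ℝ} {x : X} {l : Y} (h : IsSaddlePt (tikhonov f A b ε) x l) :
    gradient f x + ContinuousLinearMap.adjoint A l + ε • x = 0 := by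
  have h1 := hasGradientAt_tikhonov_primal hf A b ε x l
  have hmin : IsLocalMin (fun x' => tikhonov f A b ε x' l) x :=
    Eventually.of_forall fun x' => (h x' l).2
  rw [hasGradientAt_iff_hasFDerivAt] at h1
  exact (map_eq_zero_iff _ (InnerProductSpace.toDual ℝ X).injective).1 (hmin.hasFDerivAt_eq_zero h1)

lemma IsSaddlePt.feasibility {f : X → ℝ} {A : X →L[ℝ] Y} {b : Y}
    {ε : ℝ} {x : X} {l : Y} (h : IsSaddlePt (tikhonov f A b ε) x l) :
    A x - b = ε • l := by
  have h1 := hasGradientAt_tikhonov_dual f A b ε x l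
  have hmax : IsLocalMax (fun l' => tikhonov f A b ε x l') l :=
    Eventually.of_forall fun l' => (h x l').1
  rw [hasGradientAt_iff_hasFDerivAt] at h1
  rw [← sub_eq_zero]
  exact (map_eq_zero_iff _ (InnerProductSpace.toDual ℝ Y).injective).1 (hmax.hasFDerivAt_eq_zero h1)

/-- Saddle points for the weights `ε` and `η` satisfy a monotonicity inequality. -/
lemma IsSaddlePt.inner_le_zero {f : X → ℝ} (hf : Differentiable ℝ f) (hconv : ConvexOn ℝ univ f)
    {A : X →L[ℝ] Y} {b : Y} {ε η : ℝ} {x x' : X} {l l' : Y}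
    (h : IsSaddlePt (tikhonov f A b ε) x l) (h' : IsSaddlePt (tikhonov f A b η) x' l') :
    -- The two gradient inequalities for f are added; the skew coupling through A and its adjoint
    -- cancels, so only the regularisation terms survive.
    inner ℝ (ε • WithLp.toLp 2 (x, l) - η • WithLp.toLp 2 (x', l'))
      (WithLp.toLp 2 (x, l) - WithLp.toLp 2 (x', l')) ≤ (0 : ℝ) := by
  have g1 := gradient_le_of_convex hf hconv x x'
  have g2 := gradient_le_of_convex hf hconv x' x
  have e1 : gradient f x = -(ContinuousLinearMap.adjoint A l + ε • x) := by
    rw [eq_neg_iff_add_eq_zero, ← add_assoc]; exact h.gradient_eq_zero hf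
  have e2 : gradient f x' = -(ContinuousLinearMap.adjoint A l' + η • x') := by
    rw [eq_neg_iff_add_eq_zero, ← add_assoc]; exact h'.gradient_eq_zero hf
  have f1 : A x = b + ε • l := by rw [← h.feasibility]; abel
  have f2 : A x' = b + η • l' := by rw [← h'.feasibility]; abel
  rw [e1] at g1
  rw [e2] at g2
  rw [WithLp.prod_inner_apply]
  simp [inner_sub_left, inner_sub_right, inner_smul_left, inner_add_left, inner_neg_left,
    ContinuousLinearMap.adjoint_inner_left, f1, f2, inner_smul_right, inner_add_right] at g1 g2 ⊢
  rw [real_inner_comm l' l] at *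
  rw [real_inner_comm x' x] at *
  linarith

end FirstOrder

/-! ### Convergence of the Tikhonov path. -/

/-- A path with monotone bounded norms and `‖w s - w t‖² ≤ ‖w s‖² - ‖w t‖²` converges. -/
lemma exists_tendsto_of_norm_sub_sq_le {H : Type*} [NormedAddCommGroup H] [CompleteSpace H] {w : ℝ → H} {t₀ W : ℝ}
    (hW : ∀ t ∈ Ici t₀, ‖w t‖ ≤ W)
    (h : ∀ t ∈ Ici t₀, ∀ u, t ≤ u → ‖w u - w t‖ ^ 2 ≤ ‖w u‖ ^ 2 - ‖w t‖ ^ 2) :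
    ∃ w' : H, Tendsto w atTop (𝓝 w') := by
  have hmono : MonotoneOn (fun t => ‖w t‖ ^ 2) (Ici t₀) := by
    intro t ht u _ htu
    have := h t ht u htu
    have h0 := sq_nonneg ‖w u - w t‖
    simp only
    linarith
  have hbdd : ∀ t ∈ Ici t₀, ‖w t‖ ^ 2 ≤ W ^ 2 := fun t ht =>
    pow_le_pow_left₀ (norm_nonneg _) (hW t ht) 2
  set S := sSup ((fun t => ‖w t‖ ^ 2) '' Ici t₀)
  have hB : BddAbove ((fun t => ‖w t‖ ^ 2) '' Ici t₀) :=
    ⟨W ^ 2, by rintro _ ⟨t, ht, rfl⟩; exact hbdd t ht⟩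
  have hne : ((fun t => ‖w t‖ ^ 2) '' Ici t₀).Nonempty := ⟨_, t₀, self_mem_Ici, rfl⟩
  have hle : ∀ t ∈ Ici t₀, ‖w t‖ ^ 2 ≤ S := fun t ht => le_csSup hB ⟨t, ht, rfl⟩
  rw [← cauchy_map_iff_exists_tendsto, Metric.cauchy_iff]
  refine ⟨inferInstance, fun ε hε => ?_⟩
  -- Beyond T the squared norms lie within (ε/2)² of their supremum, so the increment bound puts the
  -- whole tail within ε/2 of w T.
  obtain ⟨_, ⟨T, hT, rfl⟩, hTS⟩ := exists_lt_of_lt_csSup hne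
    (show S - (ε / 2) ^ 2 < S by have : 0 < (ε / 2) ^ 2 := by positivity
                                 linarith)
  refine ⟨w '' Ici T, image_mem_map (Ici_mem_atTop T), ?_⟩
  have key : ∀ u ∈ Ici T, dist (w u) (w T) < ε / 2 := by
    intro u hu
    have h1 := h T hT u hu
    have h2 := hle u (le_trans (mem_Ici.1 hT) (mem_Ici.1 hu))
    rw [dist_eq_norm]
    refine lt_of_pow_lt_pow_left₀ 2 (by positivity) ?_
    simp only at hTS
    linarith
  rintro _ ⟨u, hu, rfl⟩ _ ⟨v, hv, rfl⟩
  have := dist_triangle_right (w u) (w v) (w T)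
  linarith [key u hu, key v hv]

section Path

variable {H : Type*} [NormedAddCommGroup H] [InnerProductSpace ℝ H]

/-- Expanding around u turns the hypothesis into η‖v − u‖² ≤ (ε − η)⟨u, v − u⟩. The last inner
product is therefore nonnegative, and expanding ‖u + (v − u)‖² finishes. The case η = 0 is allowed:
it compares with unregularised saddle points. -/
lemma norm_sub_sq_le_of_inner_le_zero {ε η : ℝ} (hη : 0 ≤ η) (hεη : η < ε) {u v : H}
    (h : inner ℝ (ε • u - η • v) (u - v) ≤ (0 : ℝ)) : ‖v - u‖ ^ 2 ≤ ‖v‖ ^ 2 - ‖u‖ ^ 2 := by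
  have e : inner ℝ (ε • u - η • v) (u - v) = η * ‖v - u‖ ^ 2 - (ε - η) * inner ℝ u (v - u) := by
    rw [← real_inner_self_eq_norm_sq]
    simp only [inner_sub_left, inner_sub_right, inner_smul_left, real_inner_comm u v]
    simp
    ring
  have hp : 0 ≤ inner ℝ u (v - u) := by
    by_contra hn
    push Not at hn
    have : 0 ≤ η * ‖v - u‖ ^ 2 := by positivity
    nlinarith
  have e2 : ‖v‖ ^ 2 = ‖u‖ ^ 2 + 2 * inner ℝ u (v - u) + ‖v - u‖ ^ 2 := by
    have := norm_add_sq_real u (v - u)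
    simpa using this
  linarith

/-- The same expansion with Cauchy–Schwarz on ⟨u, v − u⟩, then division by ‖v − u‖. -/
lemma norm_sub_le_of_inner_le_zero {ε η : ℝ} (hη : 0 < η) (hεη : η ≤ ε) {u v : H}
    (h : inner ℝ (ε • u - η • v) (u - v) ≤ (0 : ℝ)) : ‖v - u‖ ≤ (ε / η - 1) * ‖u‖ := by
  have e : inner ℝ (ε • u - η • v) (u - v) = η * ‖v - u‖ ^ 2 - (ε - η) * inner ℝ u (v - u) := by
    rw [← real_inner_self_eq_norm_sq]
    simp only [inner_sub_left, inner_sub_right, inner_smul_left, real_inner_comm u v]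
    simp
    ring
  have hcs := real_inner_le_norm u (v - u)
  have h1 : η * ‖v - u‖ ^ 2 ≤ (ε - η) * (‖u‖ * ‖v - u‖) := by
    have := mul_le_mul_of_nonneg_left hcs (sub_nonneg.2 hεη)
    linarith
  rcases (norm_nonneg (v - u)).eq_or_lt with h0 | h0
  · rw [← h0]
    have : 1 ≤ ε / η := by rwa [le_div_iff₀ hη, one_mul]
    have := norm_nonneg u
    nlinarith
  · have h2 : η * ‖v - u‖ ≤ (ε - η) * ‖u‖ := by
      refine le_of_mul_le_mul_right ?_ h0
      nlinarith
    have h3 : (ε / η - 1) * ‖u‖ = (ε - η) * ‖u‖ / η := by field_simp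
    rw [h3, le_div_iff₀ hη]
    linarith

end Path

section Curve

variable {X Y : Type*} [NormedAddCommGroup X] [InnerProductSpace ℝ X] [CompleteSpace X]
  [NormedAddCommGroup Y] [InnerProductSpace ℝ Y] [CompleteSpace Y]

lemma pairNorm_le_of_saddle {f : X → ℝ} (hf : Differentiable ℝ f)
    (hconv : ConvexOn ℝ univ f) {A : X →L[ℝ] Y} {b : Y} {ε : ℝ} (hε : 0 < ε) {x xs : X} {l ls : Y}
    (h : IsSaddlePt (tikhonov f A b ε) x l) (hs : IsSaddlePt (lagrangian f A b) xs ls) :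
    pairNorm x l ≤ pairNorm xs ls := by
  rw [lagrangian_eq_tikhonov] at hs
  have := norm_sub_sq_le_of_inner_le_zero le_rfl hε (h.inner_le_zero hf hconv hs)
  have h0 := sq_nonneg ‖(WithLp.toLp 2 (xs, ls) - WithLp.toLp 2 (x, l) : WithLp 2 (X × Y))‖
  refine le_of_sq_le_sq ?_ (pairNorm_nonneg _ _)
  simp only [pairNorm]
  linarith

/-- The path of saddle points of the regularised Lagrangians is locally Lipschitz. -/
lemma pairNorm_sub_le_of_saddle {f : X → ℝ} (hf : Differentiable ℝ f)
    (hconv : ConvexOn ℝ univ f) {A : X →L[ℝ] Y} {b : Y} {ε η : ℝ} (hη : 0 < η) (hηε : η ≤ ε)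
    {x x' : X} {l l' : Y}
    (h : IsSaddlePt (tikhonov f A b ε) x l) (h' : IsSaddlePt (tikhonov f A b η) x' l') :
    pairNorm (x' - x) (l' - l) ≤ (ε / η - 1) * pairNorm x l :=
  norm_sub_le_of_inner_le_zero hη hηε (h.inner_le_zero hf hconv h')

/-- Tikhonov regularisation: the saddle points of the regularised Lagrangians converge to the
saddle point of minimal norm. -/
theorem tendsto_saddle {f : X → ℝ} (hf : Differentiable ℝ f) (hconv : ConvexOn ℝ univ f)
    {A : X →L[ℝ] Y} {b : Y} {c p t₀ : ℝ} (hc : 0 < c) (hp : 0 < p) (ht₀ : 0 < t₀)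
    {xt : ℝ → X} {lt : ℝ → Y}
    (hsaddle : ∀ t ∈ Ici t₀, IsSaddlePt (regLagrangian f A b c p t) (xt t) (lt t))
    {xs : X} {ls : Y} (hproj : IsMinNormSaddlePt f A b xs ls) :
    Tendsto xt atTop (𝓝 xs) ∧ Tendsto lt atTop (𝓝 ls) := by
  set w : ℝ → WithLp 2 (X × Y) := fun t => WithLp.toLp 2 (xt t, lt t) with hw
  set ws : WithLp 2 (X × Y) := WithLp.toLp 2 (xs, ls) with hws
  have hs : ∀ t ∈ Ici t₀, IsSaddlePt (tikhonov f A b (c / t ^ p)) (xt t) (lt t) := fun t ht => by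
    rw [← regLagrangian_eq_tikhonov]; exact hsaddle t ht
  have hpos : ∀ t ∈ Ici t₀, 0 < c / t ^ p := fun t ht =>
    div_pos hc (Real.rpow_pos_of_pos (ht₀.trans_le ht) _)
  have hle : ∀ t ∈ Ici t₀, ‖w t‖ ≤ ‖ws‖ := fun t ht =>
    pairNorm_le_of_saddle hf hconv (hpos t ht) (hs t ht) hproj.1
  obtain ⟨w', hw'⟩ := exists_tendsto_of_norm_sub_sq_le (w := w) (t₀ := t₀) hle (by
    intro t ht u htu
    rcases htu.eq_or_lt with rfl | htu
    · simp
    have ht0 : 0 < t := ht₀.trans_le ht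
    have hu : u ∈ Ici t₀ := le_trans ht htu.le
    refine norm_sub_sq_le_of_inner_le_zero (hpos u hu).le ?_
      ((hs t ht).inner_le_zero hf hconv (hs u hu))
    exact div_lt_div_of_pos_left hc (Real.rpow_pos_of_pos ht0 _)
      (Real.rpow_lt_rpow ht0.le htu hp))
  have hx' : Tendsto xt atTop (𝓝 w'.fst) :=
    ((WithLp.continuous_fst 2 X Y).tendsto w').comp hw'
  have hl' : Tendsto lt atTop (𝓝 w'.snd) :=
    ((WithLp.continuous_snd 2 X Y).tendsto w').comp hw'
  have hε : Tendsto (fun t : ℝ => c / t ^ p) atTop (𝓝 0) :=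
    (tendsto_rpow_atTop hp).const_div_atTop c
  have hfc := hf.continuous
  have hsad' : IsSaddlePt (lagrangian f A b) w'.fst w'.snd := by
    rw [lagrangian_eq_tikhonov]
    have hcont : ∀ (u : ℝ → X) (v : ℝ → Y) (u' : X) (v' : Y), Tendsto u atTop (𝓝 u') →
        Tendsto v atTop (𝓝 v') → Tendsto (fun t => tikhonov f A b (c / t ^ p) (u t) (v t)) atTop
          (𝓝 (tikhonov f A b 0 u' v')) := by
      intro u v u' v' hu hv
      unfold tikhonov
      exact (((hfc.tendsto u').comp hu).add
        (hv.inner ((((A.continuous.tendsto u').comp hu)).sub_const b))).add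
        ((hε.div_const 2).mul ((hu.norm.pow 2).sub (hv.norm.pow 2)))
    intro x l
    constructor
    · refine le_of_tendsto_of_tendsto (hcont _ _ _ _ hx' tendsto_const_nhds)
        (hcont _ _ _ _ hx' hl') ?_
      filter_upwards [Ici_mem_atTop t₀] with t ht using (hs t ht (xt t) l).1
    · refine le_of_tendsto_of_tendsto (hcont _ _ _ _ hx' hl')
        (hcont _ _ _ _ tendsto_const_nhds hl') ?_
      filter_upwards [Ici_mem_atTop t₀] with t ht using (hs t ht x (lt t)).2
  have hmin : ‖ws‖ ≤ ‖w'‖ := hproj.2 _ _ hsad'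
  -- Limit of the monotonicity inequality against the minimal-norm point, taken with weight 0.
  -- Together with equality of norms it forces w' = ws.
  have hin : inner ℝ w' (w' - ws) ≤ (0 : ℝ) := by
    refine le_of_tendsto (hw'.inner (hw'.sub_const ws)) ?_
    filter_upwards [Ici_mem_atTop t₀] with t ht
    have h0 := hproj.1
    rw [lagrangian_eq_tikhonov] at h0
    have := (hs t ht).inner_le_zero hf hconv h0
    rw [zero_smul, sub_zero, inner_smul_left] at this
    exact nonpos_of_mul_nonpos_right this (hpos t ht)
  have hle' : ‖w'‖ ≤ ‖ws‖ := le_of_tendsto hw'.norm (by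
    filter_upwards [Ici_mem_atTop t₀] with t ht using hle t ht)
  have heq : w' = ws := by
    have e := norm_sub_sq_real w' ws
    rw [inner_sub_right, real_inner_self_eq_norm_sq] at hin
    have : ‖ws‖ = ‖w'‖ := le_antisymm hmin hle'
    have h0 : ‖w' - ws‖ ^ 2 ≤ 0 := by rw [e, this]; linarith
    rw [← sub_eq_zero, ← norm_eq_zero]
    exact pow_eq_zero_iff two_ne_zero |>.1 (le_antisymm h0 (sq_nonneg _))
  rw [heq] at hx' hl'
  exact ⟨hx', hl'⟩

end Curve

/-! ### Dini derivative of the Lyapunov function. -/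

/-- At a zero of ω the slope of the product is the slope of ω times k, so continuity of k suffices.
This is what allows k to be a norm, which may fail to be differentiable where its argument vanishes.
-/
lemma hasDerivAt_mul_of_eq_zero {ω k : ℝ → ℝ} {ω' τ : ℝ} (hω : HasDerivAt ω ω' τ)
    (h0 : ω τ = 0) (hk : ContinuousAt k τ) : HasDerivAt (fun z => ω z * k z) (ω' * k τ) τ := by
  rw [hasDerivAt_iff_tendsto_slope] at hω ⊢
  refine (hω.mul (hk.tendsto.mono_left nhdsWithin_le_nhds)).congr fun z => ?_
  simp only [slope_def_field, h0]
  ring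

lemma hasDerivAt_norm_sq_majorant {H : Type*} [NormedAddCommGroup H] [InnerProductSpace ℝ H]
    {ω : ℝ → ℝ} {ω' τ : ℝ} (hω : HasDerivAt ω ω' τ) (h0 : ω τ = 0) {u : ℝ → H} {u' : H}
    (hu : HasDerivAt u u' τ) (a : ℝ) :
    HasDerivAt (fun z => ‖u z‖ ^ 2 + 2 * a * (ω z * ‖u z‖) + a ^ 2 * (ω z * ω z))
      (2 * inner ℝ (u τ) u' + 2 * a * (ω' * ‖u τ‖)) τ := by
  have h1 := hasDerivAt_mul_of_eq_zero hω h0 hu.continuousAt.norm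
  have h2 := hasDerivAt_mul_of_eq_zero hω h0 hω.continuousAt
  refine ((hu.norm_sq.add (h1.const_mul (2 * a))).add (h2.const_mul (a ^ 2))).congr_deriv ?_
  rw [h0]
  ring

lemma norm_sub_smul_sq_le {H : Type*} [NormedAddCommGroup H] [InnerProductSpace ℝ H] {u d : H}
    {a ω : ℝ} (ha : 0 ≤ a) (h : ‖d‖ ≤ ω) :
    ‖u - a • d‖ ^ 2 ≤ ‖u‖ ^ 2 + 2 * a * (ω * ‖u‖) + a ^ 2 * (ω * ω) := by
  have h1 : ‖u - a • d‖ ≤ ‖u‖ + a * ω := by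
    refine (norm_sub_le _ _).trans ?_
    rw [norm_smul, Real.norm_of_nonneg ha]
    gcongr
  calc ‖u - a • d‖ ^ 2 ≤ (‖u‖ + a * ω) ^ 2 := pow_le_pow_left₀ (norm_nonneg _) h1 2
    _ = _ := by ring

section Gap

variable {X Y : Type*} [NormedAddCommGroup X] [InnerProductSpace ℝ X]
  [NormedAddCommGroup Y] [InnerProductSpace ℝ Y]

/-- Bounds the gap at the new weight using the old saddle point only, so no derivative of the path
is needed. Concavity in the multiplier replaces l₂ by l₁ in the first term; the saddle inequalities,
with the change of weight made explicit, bound the second term from below. -/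
lemma tikhonov_sub_le_of_saddle {f : X → ℝ} {A : X →L[ℝ] Y} {b : Y} {ε η ω : ℝ} (hη : 0 ≤ η)
    (hηε : η ≤ ε) {x₁ x₂ : X} {l₁ l₂ : Y} (h₁ : IsSaddlePt (tikhonov f A b ε) x₁ l₁)
    (h₂ : IsSaddlePt (tikhonov f A b η) x₂ l₂) (hx : ‖x₂ - x₁‖ ≤ ω) (hl : ‖l₂ - l₁‖ ≤ ω) (x : X) :
    tikhonov f A b η x l₂ - tikhonov f A b η x₂ l₂ ≤
      tikhonov f A b η x l₁ - tikhonov f A b ε x₁ l₁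
        + (ε - η) / 2 * ((‖x₁‖ + ω) ^ 2 - ‖l₁‖ ^ 2) + ω * ‖A x - b - η • l₁‖ := by
  have e1 : tikhonov f A b η x l₂ ≤ tikhonov f A b η x l₁ + ω * ‖A x - b - η • l₁‖ := by
    have h3 := real_inner_le_norm (l₂ - l₁) (A x - b - η • l₁)
    have h4 : ‖l₂ - l₁‖ * ‖A x - b - η • l₁‖ ≤ ω * ‖A x - b - η • l₁‖ := by gcongr
    have h5 : ‖l₂‖ ^ 2 = ‖l₁‖ ^ 2 + 2 * inner ℝ l₁ (l₂ - l₁) + ‖l₂ - l₁‖ ^ 2 := by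
      simpa using norm_add_sq_real l₁ (l₂ - l₁)
    have h6 : 0 ≤ η / 2 * ‖l₂ - l₁‖ ^ 2 := by positivity
    have h7 : inner ℝ (l₂ - l₁) (A x - b - η • l₁)
        = inner ℝ l₂ (A x - b) - inner ℝ l₁ (A x - b) - η * inner ℝ l₁ (l₂ - l₁) := by
      rw [inner_sub_right, inner_sub_left, inner_smul_right,
        real_inner_comm l₁ (l₂ - l₁)]
    simp only [tikhonov]
    rw [h5]
    linarith
  have e2 : tikhonov f A b η x₂ l₁ ≤ tikhonov f A b η x₂ l₂ := (h₂ x₂ l₁).1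
  have e3 : tikhonov f A b ε x₁ l₁ ≤ tikhonov f A b ε x₂ l₁ := (h₁ x₂ l₁).2
  have e4 : tikhonov f A b ε x₂ l₁
      = tikhonov f A b η x₂ l₁ + (ε - η) / 2 * (‖x₂‖ ^ 2 - ‖l₁‖ ^ 2) := by
    simp only [tikhonov]; ring
  have e5 : ‖x₂‖ ≤ ‖x₁‖ + ω := by
    have := norm_add_le x₁ (x₂ - x₁)
    rw [add_sub_cancel] at this
    linarith
  have e6 : (ε - η) / 2 * (‖x₂‖ ^ 2 - ‖l₁‖ ^ 2)
      ≤ (ε - η) / 2 * ((‖x₁‖ + ω) ^ 2 - ‖l₁‖ ^ 2) := by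
    have : 0 ≤ (ε - η) / 2 := by linarith
    gcongr
  linarith

/-- The Lyapunov function; `w = (xt, lt)` is the path of regularised saddle points, `V` the
velocity part. -/
noncomputable def lyapunov (f : X → ℝ) (A : X →L[ℝ] Y) (b : Y) (a : ℝ) (ε δ r : ℝ → ℝ)
    (x V : ℝ → X) (l : ℝ → Y) (xt : ℝ → X) (lt : ℝ → Y) (z : ℝ) : ℝ :=
  δ z * (tikhonov f A b (ε z) (x z) (lt z) - tikhonov f A b (ε z) (xt z) (lt z))
    + 1 / 2 * ‖a • (x z - xt z) + V z‖ ^ 2 + r z * (a / 2) * ‖x z - xt z‖ ^ 2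
    + 1 / 2 * ‖l z - lt z‖ ^ 2

variable [CompleteSpace X] [CompleteSpace Y]

/-- The upper right Dini derivative of the Lyapunov function. -/
lemma eventually_slope_lyapunov_lt {f : X → ℝ} (hf : Differentiable ℝ f) {A : X →L[ℝ] Y} {b : Y}
    {a : ℝ} (ha : 0 ≤ a) {ε δ r ω : ℝ → ℝ} {x V : ℝ → X} {l : ℝ → Y} {xt : ℝ → X} {lt : ℝ → Y}
    {τ ε' δ' r' ω' : ℝ} {x' V' : X} {l' : Y}
    (hε : HasDerivAt ε ε' τ) (hδ : HasDerivAt δ δ' τ) (hr : HasDerivAt r r' τ)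
    (hω : HasDerivAt ω ω' τ) (hω0 : ω τ = 0)
    (hx : HasDerivAt x x' τ) (hV : HasDerivAt V V' τ) (hl : HasDerivAt l l' τ)
    (hsad : ∀ z, τ ≤ z → IsSaddlePt (tikhonov f A b (ε z)) (xt z) (lt z))
    (hε0 : ∀ z, τ ≤ z → 0 ≤ ε z) (hεa : ∀ z, τ ≤ z → ε z ≤ ε τ)
    (hδ0 : ∀ z, τ ≤ z → 0 ≤ δ z) (hr0 : ∀ z, τ ≤ z → 0 ≤ r z)
    (hxt : ∀ z, τ ≤ z → ‖xt z - xt τ‖ ≤ ω z) (hlt : ∀ z, τ ≤ z → ‖lt z - lt τ‖ ≤ ω z)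
    {ρ : ℝ}
    (hρ : δ' * (tikhonov f A b (ε τ) (x τ) (lt τ) - tikhonov f A b (ε τ) (xt τ) (lt τ))
      + δ τ * (inner ℝ (gradient f (x τ) + ContinuousLinearMap.adjoint A (lt τ) + ε τ • x τ) x'
        + ε' / 2 * (‖x τ‖ ^ 2 - ‖xt τ‖ ^ 2) + ω' * ‖A (x τ) - b - ε τ • lt τ‖)
      + inner ℝ (a • (x τ - xt τ) + V τ) (a • x' + V') + a * (ω' * ‖a • (x τ - xt τ) + V τ‖)
      + r' * (a / 2) * ‖x τ - xt τ‖ ^ 2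
      + r τ * (a / 2) * (2 * inner ℝ (x τ - xt τ) x' + 2 * (ω' * ‖x τ - xt τ‖))
      + inner ℝ (l τ - lt τ) l' + ω' * ‖l τ - lt τ‖ < ρ) :
    ∀ᶠ z in 𝓝[>] τ, slope (lyapunov f A b a ε δ r x V l xt lt) τ z < ρ := by
  -- Majorant of the gap with the saddle point frozen at time τ; the motion of the path enters only
  -- through ω.
  set G : ℝ → ℝ := fun z => tikhonov f A b (ε z) (x z) (lt τ)
    - tikhonov f A b (ε τ) (xt τ) (lt τ)
    + (ε τ - ε z) / 2 * ((‖xt τ‖ + ω z) ^ 2 - ‖lt τ‖ ^ 2) + ω z * ‖A (x z) - b - ε z • lt τ‖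
    with hG
  have hu : HasDerivAt (fun z => a • (x z - xt τ) + V z) (a • x' + V') τ :=
    ((hx.sub_const _).const_smul a).add hV
  have q1 := hasDerivAt_norm_sq_majorant hω hω0 hu a
  have q2 := hasDerivAt_norm_sq_majorant hω hω0 (hx.sub_const (xt τ)) 1
  have q3 := hasDerivAt_norm_sq_majorant hω hω0 (hl.sub_const (lt τ)) 1
  have hAx : HasDerivAt (fun z => A (x z) - b) (A x') τ := by
    simpa using (A.hasFDerivAt.comp_hasDerivAt τ hx).sub_const b
  have hGd : HasDerivAt G (inner ℝ (gradient f (x τ) + ContinuousLinearMap.adjoint A (lt τ)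
      + ε τ • x τ) x' + ε' / 2 * (‖x τ‖ ^ 2 - ‖xt τ‖ ^ 2)
      + ω' * ‖A (x τ) - b - ε τ • lt τ‖) τ := by
    have d1 : HasDerivAt (fun z => f (x z)) (inner ℝ (gradient f (x τ)) x') τ := by
      rw [inner_gradient_left]
      exact (hf (x τ)).hasFDerivAt.comp_hasDerivAt τ hx
    have d2 : HasDerivAt (fun z => (inner ℝ (lt τ) (A (x z) - b) : ℝ)) (inner ℝ (lt τ) (A x')) τ := by
      simpa using (hasDerivAt_const τ (lt τ)).inner ℝ hAx
    have d3 : HasDerivAt (fun z => ε z / 2 * (‖x z‖ ^ 2 - ‖lt τ‖ ^ 2))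
        (ε' / 2 * (‖x τ‖ ^ 2 - ‖lt τ‖ ^ 2) + ε τ / 2 * (2 * inner ℝ (x τ) x')) τ :=
      (hε.div_const 2).mul (hx.norm_sq.sub_const _)
    have d4 : HasDerivAt (fun z => (ε τ - ε z) / 2 * ((‖xt τ‖ + ω z) ^ 2 - ‖lt τ‖ ^ 2))
        (-ε' / 2 * (‖xt τ‖ ^ 2 - ‖lt τ‖ ^ 2)) τ := by
      have := ((hε.const_sub (ε τ)).div_const 2).mul
        (((hω.const_add ‖xt τ‖).pow 2).sub_const (‖lt τ‖ ^ 2))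
      refine this.congr_deriv ?_
      simp [hω0]
    have d5 := hasDerivAt_mul_of_eq_zero hω hω0
      (k := fun z => ‖A (x z) - b - ε z • lt τ‖)
      (hAx.continuousAt.sub (hε.continuousAt.smul continuousAt_const)).norm
    refine (((((d1.add d2).add d3).sub_const _).add d4).add d5).congr_deriv ?_
    simp only [inner_add_left, inner_smul_left, ContinuousLinearMap.adjoint_inner_left]
    simp
    ring
  set F : ℝ → ℝ := fun z => δ z * G z
    + 1 / 2 * (‖a • (x z - xt τ) + V z‖ ^ 2 + 2 * a * (ω z * ‖a • (x z - xt τ) + V z‖)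
        + a ^ 2 * (ω z * ω z))
    + r z * (a / 2) * (‖x z - xt τ‖ ^ 2 + 2 * 1 * (ω z * ‖x z - xt τ‖) + 1 ^ 2 * (ω z * ω z))
    + 1 / 2 * (‖l z - lt τ‖ ^ 2 + 2 * 1 * (ω z * ‖l z - lt τ‖) + 1 ^ 2 * (ω z * ω z)) with hF
  have hFd := (((hδ.mul hGd).add (q1.const_mul (1 / 2))).add
    ((hr.mul_const (a / 2)).mul q2)).add (q3.const_mul (1 / 2))
  have hGτ : G τ = tikhonov f A b (ε τ) (x τ) (lt τ) - tikhonov f A b (ε τ) (xt τ) (lt τ) := by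
    simp [hG, hω0]
  -- F lies above the Lyapunov function to the right of τ and agrees with it at τ, so its slopes
  -- from τ dominate.
  have hle : ∀ z, τ ≤ z → lyapunov f A b a ε δ r x V l xt lt z ≤ F z := by
    intro z hz
    have g1 := tikhonov_sub_le_of_saddle (hε0 z hz) (hεa z hz) (hsad τ le_rfl) (hsad z hz)
      (hxt z hz) (hlt z hz) (x z)
    have g2 := norm_sub_smul_sq_le (u := a • (x z - xt τ) + V z) ha (hxt z hz)
    have g3 := norm_sub_smul_sq_le (u := x z - xt τ) zero_le_one (hxt z hz)
    have g4 := norm_sub_smul_sq_le (u := l z - lt τ) zero_le_one (hlt z hz)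
    have e2 : a • (x z - xt τ) + V z - a • (xt z - xt τ) = a • (x z - xt z) + V z := by module
    have e3 : x z - xt τ - (1 : ℝ) • (xt z - xt τ) = x z - xt z := by module
    have e4 : l z - lt τ - (1 : ℝ) • (lt z - lt τ) = l z - lt z := by module
    rw [e2] at g2
    rw [e3] at g3
    rw [e4] at g4
    have g5 := mul_le_mul_of_nonneg_left g1 (hδ0 z hz)
    have g6 := mul_le_mul_of_nonneg_left g3
      (mul_nonneg (hr0 z hz) (div_nonneg ha (zero_le_two)))
    simp only [lyapunov, hF, hG]
    linarith
  have hτ : lyapunov f A b a ε δ r x V l xt lt τ = F τ := by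
    simp only [lyapunov, hF, hGτ, hω0]
    ring
  have hs : ∀ᶠ z in 𝓝[>] τ, slope F τ z < ρ := by
    have h1 := (hasDerivAt_iff_tendsto_slope.1 hFd).mono_left
      (nhdsWithin_mono τ (fun z (hz : τ < z) => hz.ne'))
    refine h1.eventually_lt_const ?_
    refine lt_of_eq_of_lt ?_ hρ
    rw [hGτ]
    simp only [hω0]
    ring
  filter_upwards [hs, self_mem_nhdsWithin] with z hz hzτ
  have hzτ : τ < z := hzτ
  refine lt_of_le_of_lt ?_ hz
  rw [slope_def_field, slope_def_field, hτ]
  have := hle z hzτ.le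
  have h0 : 0 < z - τ := sub_pos.2 hzτ
  gcongr

/-- The decay inequality for the Dini derivative of the Lyapunov function along the dynamics. -/
lemma dini_lyapunov_le {f : X → ℝ} (hf : Differentiable ℝ f) (hconv : ConvexOn ℝ univ f)
    {A : X →L[ℝ] Y} {b : Y} {a ε δ r β M Γ ε' δ' r' ω' : ℝ} (ha : 0 ≤ a) (hβ : 0 ≤ β)
    (hM : 0 ≤ M) (hΓ : 0 ≤ Γ) (hε' : ε' ≤ 0) (hω' : 0 ≤ ω')
    {x x' g xt V V' : X} {l l' lt : Y}
    (hg : g = gradient f x + ContinuousLinearMap.adjoint A l + ε • x)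
    (hV : V = M • x' + Γ • g) (hV' : V' = -((r + a) • x') - β • g)
    (hl' : l' = (a * β) • (A x - b - ε • l) + δ • A x')
    (hδ : δ = r * Γ + β * M) (hδ0 : 0 ≤ δ)
    (hsad : IsSaddlePt (tikhonov f A b ε) xt lt) :
    δ' * (tikhonov f A b ε x lt - tikhonov f A b ε xt lt)
      + δ * (inner ℝ (gradient f x + ContinuousLinearMap.adjoint A lt + ε • x) x'
        + ε' / 2 * (‖x‖ ^ 2 - ‖xt‖ ^ 2) + ω' * ‖A x - b - ε • lt‖)
      + inner ℝ (a • (x - xt) + V) (a • x' + V') + a * (ω' * ‖a • (x - xt) + V‖)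
      + r' * (a / 2) * ‖x - xt‖ ^ 2
      + r * (a / 2) * (2 * inner ℝ (x - xt) x' + 2 * (ω' * ‖x - xt‖))
      + inner ℝ (l - lt) l' + ω' * ‖l - lt‖ ≤
    (δ' - a * β) * (tikhonov f A b ε x lt - tikhonov f A b ε xt lt)
      - a * β * (ε / 2) * ‖x - xt‖ ^ 2 - a * β * ε * ‖l - lt‖ ^ 2 - r * M * ‖x'‖ ^ 2
      - β * Γ * ‖g‖ ^ 2 + δ * (-ε' * ‖xt‖ + ω' * ‖A‖) * ‖x - xt‖
      + a * ω' * (a * ‖x - xt‖ + M * ‖x'‖ + Γ * ‖g‖) + r' * (a / 2) * ‖x - xt‖ ^ 2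
      + r * a * ω' * ‖x - xt‖ + ω' * ‖l - lt‖ := by
  have hfeas : A xt = b + ε • lt := by rw [← hsad.feasibility]; abel
  have n1 : ‖a • (x - xt) + V‖ ≤ a * ‖x - xt‖ + M * ‖x'‖ + Γ * ‖g‖ := by
    rw [hV]
    refine (norm_add_le _ _).trans ?_
    have := norm_add_le (M • x') (Γ • g)
    rw [norm_smul, norm_smul, Real.norm_of_nonneg hM, Real.norm_of_nonneg hΓ] at this
    rw [norm_smul, Real.norm_of_nonneg ha]
    linarith
  have n2 : ‖A x - b - ε • lt‖ ≤ ‖A‖ * ‖x - xt‖ := by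
    have : A x - b - ε • lt = A (x - xt) := by rw [map_sub, hfeas]; abel
    rw [this]
    exact A.le_opNorm _
  -- The quadratic part of the expansion around xt has the sign of ε' ≤ 0 and is discarded.
  have n3 : ε' / 2 * (‖x‖ ^ 2 - ‖xt‖ ^ 2) ≤ -ε' * (‖xt‖ * ‖x - xt‖) := by
    have h5 : ‖x‖ ^ 2 = ‖xt‖ ^ 2 + 2 * inner ℝ xt (x - xt) + ‖x - xt‖ ^ 2 := by
      simpa using norm_add_sq_real xt (x - xt)
    have h6 := neg_le_of_abs_le (abs_real_inner_le_norm xt (x - xt))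
    have h7 : 0 ≤ ‖x - xt‖ ^ 2 := sq_nonneg _
    rw [h5]
    nlinarith
  have n1' : a * (ω' * ‖a • (x - xt) + V‖) ≤ a * (ω' * (a * ‖x - xt‖ + M * ‖x'‖ + Γ * ‖g‖)) := by
    gcongr
  have n23 : δ * (ε' / 2 * (‖x‖ ^ 2 - ‖xt‖ ^ 2) + ω' * ‖A x - b - ε • lt‖)
      ≤ δ * (-ε' * (‖xt‖ * ‖x - xt‖) + ω' * (‖A‖ * ‖x - xt‖)) := by gcongr
  -- Strong convexity in the primal variable. As g is taken at l rather than lt, the coupling ⟨l −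
  -- lt, A(x − xt)⟩ has to be subtracted; the dual equation returns it in `e2`.
  have key : tikhonov f A b ε x lt - tikhonov f A b ε xt lt + ε / 2 * ‖x - xt‖ ^ 2
      ≤ inner ℝ g (x - xt) - inner ℝ (l - lt) (A (x - xt)) := by
    have g1 := gradient_le_of_convex hf hconv x xt
    have h5 : ‖xt‖ ^ 2 = ‖x‖ ^ 2 + 2 * inner ℝ x (xt - x) + ‖xt - x‖ ^ 2 := by
      simpa using norm_add_sq_real x (xt - x)
    have e1 : inner ℝ g (x - xt) - inner ℝ (l - lt) (A (x - xt))
        = -inner ℝ (gradient f x) (xt - x) + inner ℝ lt (A x - b) - inner ℝ lt (A xt - b)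
          - ε * inner ℝ x (xt - x) := by
      rw [hg]
      simp only [inner_add_left, inner_sub_left, inner_sub_right, inner_smul_left,
        ContinuousLinearMap.adjoint_inner_left, map_sub]
      simp
      ring
    rw [e1]
    simp only [tikhonov]
    rw [norm_sub_rev x xt, h5]
    linarith
  have hkey := mul_le_mul_of_nonneg_left key (mul_nonneg ha hβ)
  have e2 : inner ℝ (l - lt) l' = a * β * (inner ℝ (l - lt) (A (x - xt)) - ε * ‖l - lt‖ ^ 2)
      + δ * inner ℝ (l - lt) (A x') := by
    have : l' = (a * β) • (A (x - xt) - ε • (l - lt)) + δ • A x' := by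
      rw [hl', map_sub, hfeas]; module
    rw [this, inner_add_right, inner_smul_right, inner_smul_right, inner_sub_right,
      inner_smul_right, real_inner_self_eq_norm_sq]
  have e3 : inner ℝ (gradient f x + ContinuousLinearMap.adjoint A lt + ε • x) x'
      = inner ℝ g x' - inner ℝ (l - lt) (A x') := by
    rw [hg]
    simp only [inner_add_left, inner_sub_left, ContinuousLinearMap.adjoint_inner_left]
    ring
  have e4 : inner ℝ (a • (x - xt) + V) (a • x' + V')
      = -(r * a) * inner ℝ (x - xt) x' - a * β * inner ℝ g (x - xt) - r * M * ‖x'‖ ^ 2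
        - δ * inner ℝ g x' - β * Γ * ‖g‖ ^ 2 := by
    have : a • x' + V' = -(r • x') - β • g := by rw [hV']; module
    rw [this, hV, hδ]
    simp only [inner_add_left, inner_sub_right (𝕜 := ℝ) _ (-(r • x')), inner_neg_right, inner_smul_left,
      inner_smul_right, real_inner_self_eq_norm_sq, real_inner_comm g x',
      real_inner_comm g (x - xt)]
    simp only [conj_trivial]
    ring
  -- Now δ⟨g, x'⟩ cancels between `e3` and `e4`, δ⟨l − lt, A x'⟩ between `e2` and `e3`, and ra⟨x −
  -- xt, x'⟩ against the derivative of the r-weighted term.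
  rw [e2, e3, e4]
  linarith

end Gap

/-! ### Comparison principle, absorption of errors and coefficient estimates. -/

/-- A Grönwall-type comparison for a function whose upper right Dini derivative is controlled. -/
lemma exists_le_mul_of_dini {E Φ Φ' : ℝ → ℝ} {T a K k κ : ℝ} (ha : 0 < a) (hK : 0 ≤ K)
    (hκ : κ < 1) (hT : 0 < T) (hE : ContinuousOn E (Ici T)) (hΦ : ∀ t ∈ Ici T, 0 < Φ t)
    (hΦd : ∀ t ∈ Ici T, HasDerivAt Φ (Φ' t) t) (hΦ' : ∀ t ∈ Ici T, -(k / t * Φ t) ≤ Φ' t)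
    (hD : ∀ t ∈ Ici T, ∀ ρ, -(a * t ^ (-κ)) * E t + K * (t ^ (-κ) * Φ t) < ρ →
      ∀ᶠ z in 𝓝[>] t, slope E t z < ρ) :
    ∃ C, ∀ᶠ t in atTop, E t ≤ C * Φ t := by
  have hlim : Tendsto (fun t : ℝ => k * t ^ (-(1 - κ))) atTop (𝓝 0) := by
    simpa using (tendsto_rpow_neg_atTop (sub_pos.2 hκ)).const_mul k
  obtain ⟨T₁, hT₁⟩ := eventually_atTop.1 (hlim.eventually_lt_const (half_pos ha))
  set S := max T T₁ with hS
  have hST : T ≤ S := le_max_left _ _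
  have hS0 : 0 < S := hT.trans_le hST
  set C := max (E S / Φ S) (2 * K / a + 1) with hC
  have hC1 : E S ≤ C * Φ S := by
    rw [← div_le_iff₀ (hΦ S hST)]; exact le_max_left _ _
  -- The contraction rate a is split in two: one half dominates the decay of Φ, the other the source
  -- K. The +1 in C makes this strict, as the barrier argument requires at contact points.
  have hC2 : K < C * (a / 2) := by
    have : 2 * K / a + 1 ≤ C := le_max_right _ _
    have h1 : 2 * K / a * (a / 2) = K := by field_simp
    nlinarith
  refine ⟨C, eventually_atTop.2 ⟨S, fun t ht => ?_⟩⟩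
  have hsub : ∀ {u}, S ≤ u → u ∈ Ici T := fun hu => hST.trans hu
  refine image_le_of_liminf_slope_right_lt_deriv_boundary' (a := S) (b := t)
    (f' := fun t => -(a * t ^ (-κ)) * E t + K * (t ^ (-κ) * Φ t)) (B := fun t => C * Φ t)
    (B' := fun t => C * Φ' t) (hE.mono fun u hu => hsub hu.1)
    (fun u hu ρ hρ => (hD u (hsub hu.1) ρ hρ).frequently) hC1
    (fun u hu => ((hΦd u (hsub hu.1)).const_mul C).continuousAt.continuousWithinAt)
    (fun u hu => ((hΦd u (hsub hu.1)).const_mul C).hasDerivWithinAt) ?_ ⟨ht, le_rfl⟩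
  intro u hu hEu
  have hu0 : 0 < u := hS0.trans_le hu.1
  have hσ : 0 < u ^ (-κ) := Real.rpow_pos_of_pos hu0 _
  have hΦu := hΦ u (hsub hu.1)
  have h1 := hT₁ u ((le_max_right _ _).trans hu.1)
  have h2 : k / u = k * u ^ (-(1 - κ)) * u ^ (-κ) := by
    rw [mul_assoc, ← Real.rpow_add hu0, show -(1 - κ) + -κ = -1 by ring, Real.rpow_neg_one]
    rfl
  have h3 := hΦ' u (hsub hu.1)
  have hC0 : 0 < C := by
    by_contra hn
    push Not at hn
    nlinarith
  have h4 : k / u ≤ a / 2 * u ^ (-κ) := by rw [h2]; gcongr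
  have h5 : -(a / 2 * u ^ (-κ) * Φ u) ≤ Φ' u := by
    refine le_trans ?_ h3
    rw [neg_le_neg_iff]
    gcongr
  have h6 : C * -(a / 2 * u ^ (-κ) * Φ u) ≤ C * Φ' u := by gcongr
  refine lt_of_lt_of_le ?_ h6
  simp only [hEu]
  have h7 : K * (u ^ (-κ) * Φ u) < C * (a / 2) * (u ^ (-κ) * Φ u) := by gcongr
  linarith

lemma mul_le_mul_sq_add {k : ℝ} (hk : 0 < k) (u x : ℝ) : u * x ≤ k * x ^ 2 + u ^ 2 / (4 * k) := by
  have h : k * x ^ 2 + u ^ 2 / (4 * k) - u * x = (2 * k * x - u) ^ 2 / (4 * k) := by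
    field_simp; ring
  have : 0 ≤ (2 * k * x - u) ^ 2 / (4 * k) := by positivity
  linarith

/-- Absorption of the error terms of the Lyapunov analysis into the dissipation. -/
lemma absorption {a P β r M Γ δ δ' r' ω' N ν E G X Λ U g : ℝ} (ha : 0 < a) (hP : 0 < P)
    (hβ : 0 < β) (hM : 0 ≤ M) (hΓ : 0 ≤ Γ) (hr : 1 / 2 ≤ r) (hr2 : r ≤ 2)
    (hω' : 0 ≤ ω') (hG : 0 ≤ G) (hX : 0 ≤ X) (hν : 0 ≤ ν)
    (hδ' : δ' ≤ a / 2 * β) (hr' : r' ≤ P / 8) (h1 : ν * δ ≤ a / 2 * β)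
    (h2 : ν * (3 / 2 * a ^ 2 + a) ≤ a * P / 4) (h3 : ν * (3 / 2 * M) ≤ 1 / 4)
    (h4 : ν * (3 / 2 * Γ) ≤ β / 2) (h5 : ν * (1 / 2) ≤ a * P / 2)
    (hE : E ≤ δ * G + 3 / 2 * (a ^ 2 * X ^ 2 + M ^ 2 * U ^ 2 + Γ ^ 2 * g ^ 2)
      + r * (a / 2) * X ^ 2 + 1 / 2 * Λ ^ 2) :
    (δ' - a * β) * G - a * (P / 2) * X ^ 2 - a * P * Λ ^ 2 - r * M * U ^ 2 - β * Γ * g ^ 2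
      + δ * N * X + a * ω' * (a * X + M * U + Γ * g) + r' * (a / 2) * X ^ 2 + r * a * ω' * X
      + ω' * Λ ≤
    -ν * E + (4 * (δ * N) ^ 2 / (a * P) + (4 * a ^ 3 + 16 * a + 1 / (2 * a)) * (ω' ^ 2 / P)
      + a ^ 2 * (M * ω' ^ 2) + a ^ 2 / 2 * (Γ * ω' ^ 2 / β)) := by
  -- The budget aP/2 for X² is spent exactly: three Young terms of aP/16, aP/16 for r', and aP/4 for
  -- νE. The dissipation in G, g and Λ is split in halves; that in U supplies M/2, split into two
  -- quarters.
  have hk : 0 < a * P / 16 := by positivity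
  have y1 := mul_le_mul_sq_add hk (δ * N) X
  have y2 := mul_le_mul_sq_add hk (a ^ 2 * ω') X
  have y3 := mul_le_mul_sq_add hk (2 * a * ω') X
  have y4 := mul_le_mul_of_nonneg_left
    (mul_le_mul_sq_add (show (0 : ℝ) < 1 / 4 by norm_num) (a * ω') U) hM
  have y5 := mul_le_mul_of_nonneg_left (mul_le_mul_sq_add (half_pos hβ) (a * ω') g) hΓ
  have y6 := mul_le_mul_sq_add (show 0 < a * P / 2 by positivity) ω' Λ
  have e1 : (δ * N) ^ 2 / (4 * (a * P / 16)) = 4 * (δ * N) ^ 2 / (a * P) := by field_simp; norm_num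
  have e2 : (a ^ 2 * ω') ^ 2 / (4 * (a * P / 16)) = 4 * a ^ 3 * (ω' ^ 2 / P) := by
    field_simp; norm_num
  have e3 : (2 * a * ω') ^ 2 / (4 * (a * P / 16)) = 16 * a * (ω' ^ 2 / P) := by
    field_simp; ring
  have e5 : Γ * ((a * ω') ^ 2 / (4 * (β / 2))) = a ^ 2 / 2 * (Γ * ω' ^ 2 / β) := by
    field_simp; norm_num
  have e6 : ω' ^ 2 / (4 * (a * P / 2)) = 1 / (2 * a) * (ω' ^ 2 / P) := by field_simp; norm_num
  rw [e1] at y1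
  rw [e2] at y2
  rw [e3] at y3
  rw [mul_add, e5] at y5
  rw [e6] at y6
  have z1 : (δ' - a * β) * G ≤ -(a / 2 * β) * G := by gcongr; linarith
  have z2 : r' * (a / 2) * X ^ 2 ≤ P / 8 * (a / 2) * X ^ 2 := by gcongr
  have z3 : r * a * ω' * X ≤ 2 * a * ω' * X := by gcongr
  have z4 : 1 / 2 * M * U ^ 2 ≤ r * M * U ^ 2 := by gcongr
  have w0 := mul_le_mul_of_nonneg_left hE hν
  have w1 := mul_le_mul_of_nonneg_right h1 hG
  have w2 := mul_le_mul_of_nonneg_right h2 (sq_nonneg X)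
  have w3 := mul_le_mul_of_nonneg_right h3 (mul_nonneg hM (sq_nonneg U))
  have w4 := mul_le_mul_of_nonneg_right h4 (mul_nonneg hΓ (sq_nonneg g))
  have w5 := mul_le_mul_of_nonneg_right h5 (sq_nonneg Λ)
  have w6 : ν * (r * (a / 2) * X ^ 2) ≤ ν * (a * X ^ 2) := by
    have : r * (a / 2) * X ^ 2 ≤ 2 * (a / 2) * X ^ 2 := by gcongr
    have h := mul_le_mul_of_nonneg_left this hν
    linarith
  linarith

/-- Size of the residual error terms, with `Q = t ^ q`, `S = t ^ s`, `D = t ^ p`. -/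
lemma residual_le {a P β M Γ δ ω' N t Q S D μ k₁ c γ n w : ℝ} (ha : 0 < a) (hγ : 0 < γ) (hc : 0 < c)
    (ht : 1 ≤ t) (hQ : 1 ≤ Q) (hS : 1 ≤ S) (hD : 1 ≤ D) (hμ : 0 < μ) (hμ1 : μ * Q ≤ k₁)
    (hμ2 : γ ≤ μ * Q * S) (hP : c / 2 * (Q * S / D) ≤ P) (hβ : Q * S / 2 ≤ β) (hM : M = μ * Q)
    (hΓ : Γ = γ * Q) (hδ0 : 0 ≤ δ) (hδ : δ ≤ 3 * (μ * Q ^ 2 * S)) (hN0 : 0 ≤ N) (hN : N ≤ n / t)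
    (hω : ω' = w / t) :
    4 * (δ * N) ^ 2 / (a * P) + (4 * a ^ 3 + 16 * a + 1 / (2 * a)) * (ω' ^ 2 / P)
      + a ^ 2 * (M * ω' ^ 2) + a ^ 2 / 2 * (Γ * ω' ^ 2 / β) ≤
    (72 * n ^ 2 * k₁ / (a * c) + (4 * a ^ 3 + 16 * a + 1 / (2 * a)) * (2 * w ^ 2 / (c * γ))
      + a ^ 2 * w ^ 2 + a ^ 2 * w ^ 2) * (μ * (Q ^ 3 * S * D / t ^ 2)) := by
  have ht0 : 0 < t := by linarith
  have hQ0 : 0 < Q := by linarith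
  have hS0 : 0 < S := by linarith
  have hD0 : 0 < D := by linarith
  have hk₁ : 0 < k₁ := lt_of_lt_of_le (by positivity) hμ1
  have hP0 : 0 < P := lt_of_lt_of_le (by positivity) hP
  have hQD : 1 ≤ Q ^ 3 * S := by
    have : 1 ≤ Q ^ 3 := one_le_pow₀ hQ
    nlinarith
  have b1 : 4 * (δ * N) ^ 2 / (a * P) ≤ 72 * n ^ 2 * k₁ / (a * c) * (μ * (Q ^ 3 * S * D / t ^ 2)) := by
    have hn : 0 ≤ n / t := hN0.trans hN
    calc 4 * (δ * N) ^ 2 / (a * P)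
        ≤ 4 * (3 * (μ * Q ^ 2 * S) * (n / t)) ^ 2 / (a * (c / 2 * (Q * S / D))) := by gcongr
      _ = 72 * n ^ 2 * μ / (a * c) * (μ * (Q ^ 3 * S * D / t ^ 2)) := by field_simp; ring
      -- This term carries a factor μ², one of which is bounded by k₁; its powers of Q, S and D fix
      -- the common size of the residual.
      _ ≤ _ := by
        have : μ ≤ k₁ := by nlinarith
        gcongr
  have b2 : ω' ^ 2 / P ≤ 2 * w ^ 2 / (c * γ) * (μ * (Q ^ 3 * S * D / t ^ 2)) := by
    calc ω' ^ 2 / P ≤ (w / t) ^ 2 / (c / 2 * (Q * S / D)) := by rw [hω]; gcongr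
      _ = 2 * w ^ 2 / (c * γ) * (γ / (Q * S) * (1 * D / t ^ 2)) := by field_simp
      _ ≤ 2 * w ^ 2 / (c * γ) * (μ * (Q ^ 3 * S * D / t ^ 2)) := by
        -- The lower mass bound supplies the factor μ that this term lacks.
        have : γ / (Q * S) ≤ μ := by
          rw [div_le_iff₀ (by positivity)]; linarith
        gcongr
  have b3 : M * ω' ^ 2 ≤ w ^ 2 * (μ * (Q ^ 3 * S * D / t ^ 2)) := by
    calc M * ω' ^ 2 = w ^ 2 * (μ * (Q * 1 * 1 / t ^ 2)) := by rw [hM, hω]; field_simp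
      _ ≤ _ := by
        have : Q ≤ Q ^ 3 := le_self_pow₀ hQ (by norm_num)
        gcongr
  have b4 : Γ * ω' ^ 2 / β ≤ 2 * w ^ 2 * (μ * (Q ^ 3 * S * D / t ^ 2)) := by
    calc Γ * ω' ^ 2 / β ≤ γ * Q * (w / t) ^ 2 / (Q * S / 2) := by rw [hΓ, hω]; gcongr
      _ = 2 * w ^ 2 * (γ / (Q * S) * (Q * 1 * 1 / t ^ 2)) := by field_simp
      _ ≤ _ := by
        have : γ / (Q * S) ≤ μ := by
          rw [div_le_iff₀ (by positivity)]; linarith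
        have : Q ≤ Q ^ 3 := le_self_pow₀ hQ (by norm_num)
        gcongr
  have b2' := mul_le_mul_of_nonneg_left b2
    (show 0 ≤ 4 * a ^ 3 + 16 * a + 1 / (2 * a) by positivity)
  have b3' := mul_le_mul_of_nonneg_left b3 (sq_nonneg a)
  have b4' := mul_le_mul_of_nonneg_left b4 (show 0 ≤ a ^ 2 / 2 by positivity)
  linarith

/-- Bounds for the coefficients, with `Q = t ^ q`, `S = t ^ s` and `μ, μ₁, μ₂` the mass and its
first two derivatives. -/
lemma coef_bounds {γ q s k₁ k₂ a t Q S μ μ₁ μ₂ β β' r r' δ' : ℝ} (hγ : 0 < γ) (hq0 : 0 < q)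
    (hq1 : q < 1) (hs : 0 < s) (hk₂ : 0 < k₂) (ha : 0 < a) (ht : 1 ≤ t) (hQ : 1 ≤ Q)
    (hS : 1 ≤ S) (hμ : 0 < μ) (hμ1 : μ * Q ≤ k₁) (hμ2 : γ ≤ μ * Q * S)
    (hm1 : t * |μ₁| ≤ k₂ * μ) (hm2 : t ^ 2 * |μ₂| ≤ k₂ * μ)
    (hβ : β = Q * S - γ * q * (Q / t))
    (hβ' : β' = (q + s) * (Q * S / t) - γ * q * ((q - 1) * (Q / t / t)))
    (hr : r = 1 - μ₁ * Q - q * (μ * (Q / t)))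
    (hr' : r' = -(μ₂ * Q + μ₁ * (q * (Q / t)))
      - q * (μ₁ * (Q / t) + μ * ((q - 1) * (Q / t / t))))
    (hδ' : δ' = r' * (γ * Q) + r * (γ * (q * (Q / t))) + (β' * (μ * Q)
      + β * (μ₁ * Q + μ * (q * (Q / t)))))
    (ht1 : 2 * γ ≤ t) (ht2 : 2 * (k₁ * k₂ + k₁) ≤ t)
    (ht3 : 4 * (γ * (k₁ * (3 * k₂ + 1)) + 2 * γ + k₁ * (q + s + γ) + (k₁ * k₂ + k₁)) ≤ a * t) :
    Q * S / 2 ≤ β ∧ β ≤ Q * S ∧ 1 / 2 ≤ r ∧ r ≤ 2 ∧ t ^ 2 * r' ≤ k₁ * (3 * k₂ + 1) ∧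
      δ' ≤ a / 2 * β ∧ r * (γ * Q) + β * (μ * Q) ≤ 3 * (μ * Q ^ 2 * S) := by
  have ht0 : 0 < t := by linarith
  have hk₁ : 0 < k₁ := lt_of_lt_of_le (by positivity) hμ1
  have hA0 : 0 < μ * Q := by positivity
  have hA1 : t * |μ₁ * Q| ≤ k₁ * k₂ := by
    rw [abs_mul, abs_of_pos (show 0 < Q by linarith)]
    calc t * (|μ₁| * Q) = t * |μ₁| * Q := by ring
      _ ≤ k₂ * μ * Q := by gcongr
      _ = k₂ * (μ * Q) := by ring
      _ ≤ k₂ * k₁ := by gcongr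
      _ = _ := by ring
  have hA2 : t ^ 2 * |μ₂ * Q| ≤ k₁ * k₂ := by
    rw [abs_mul, abs_of_pos (show 0 < Q by linarith)]
    calc t ^ 2 * (|μ₂| * Q) = t ^ 2 * |μ₂| * Q := by ring
      _ ≤ k₂ * μ * Q := by gcongr
      _ = k₂ * (μ * Q) := by ring
      _ ≤ k₂ * k₁ := by gcongr
      _ = _ := by ring
  -- A₀, A₁, A₂ are bounded by constants times 1, 1/t, 1/t²; all remaining estimates are in terms of
  -- them and of R = QS.
  set A₀ := μ * Q with hA₀
  set A₁ := μ₁ * Q with hA₁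
  set A₂ := μ₂ * Q with hA₂
  set R := Q * S with hR
  have hQR : Q ≤ R := by rw [hR]; exact le_mul_of_one_le_right (by linarith) hS
  have hR0 : 0 < R := by linarith
  have hk12 : 0 < k₁ * k₂ := by positivity
  have hA1u : t * A₁ ≤ k₁ * k₂ := (mul_le_mul_of_nonneg_left (le_abs_self _) ht0.le).trans hA1
  have hA1l : -(k₁ * k₂) ≤ t * A₁ := by
    have := mul_le_mul_of_nonneg_left (neg_abs_le A₁) ht0.le
    linarith
  have hA2l : -(k₁ * k₂) ≤ t ^ 2 * A₂ := by
    have := mul_le_mul_of_nonneg_left (neg_abs_le A₂) (sq_nonneg t)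
    linarith
  have hQt : Q / t ≤ R / t := by gcongr
  have hQt0 : 0 < Q / t := by positivity
  have hβ1 : β ≤ R := by
    rw [hβ]
    have : 0 ≤ γ * q * (Q / t) := by positivity
    linarith
  have hβ2 : R / 2 ≤ β := by
    have : γ * q * (Q / t) ≤ R / 2 := by
      calc γ * q * (Q / t) ≤ γ * 1 * (R / t) := by gcongr
        _ = γ * R / t := by ring
        _ ≤ R / 2 := by
          rw [div_le_div_iff₀ ht0 two_pos]
          have := mul_le_mul_of_nonneg_right ht1 hR0.le
          linarith
    rw [hβ]
    linarith
  have hrt : t * r = t - t * A₁ - q * A₀ := by rw [hr, hA₁, hA₀]; field_simp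
  have hqA0 : q * A₀ ≤ 1 * k₁ := by gcongr
  have hqq : q * (1 - q) ≤ 1 := by nlinarith only [hq0, hq1]
  have hqq0 : 0 ≤ q * (1 - q) := mul_nonneg hq0.le (by linarith)
  have hqA0' : 0 ≤ q * A₀ := by positivity
  have hr1 : 1 / 2 ≤ r := le_of_mul_le_mul_left (by linarith) ht0
  have hr2 : r ≤ 2 := le_of_mul_le_mul_left (by linarith) ht0
  have hrt' : t ^ 2 * r' = -(t ^ 2 * A₂) - 2 * q * (t * A₁) + q * (1 - q) * A₀ := by
    rw [hr', hA₁, hA₀, hA₂]; field_simp; ring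
  have hr'b : t ^ 2 * r' ≤ k₁ * (3 * k₂ + 1) := by
    have e1 : q * -(t * A₁) ≤ 1 * (k₁ * k₂) :=
      (mul_le_mul_of_nonneg_left (by linarith) hq0.le).trans
        (mul_le_mul_of_nonneg_right hq1.le hk12.le)
    have e2 : q * (1 - q) * A₀ ≤ 1 * k₁ := by gcongr
    rw [hrt']
    linarith
  refine ⟨hβ2, hβ1, hr1, hr2, hr'b, ?_, ?_⟩
  · have c1 : t * (r' * (γ * Q)) ≤ γ * (k₁ * (3 * k₂ + 1)) * R := by
      have hb : 0 ≤ k₁ * (3 * k₂ + 1) := by positivity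
      have h1 : t * r' ≤ k₁ * (3 * k₂ + 1) := by
        by_contra! hn
        have h0 : 0 ≤ t * r' := by linarith
        have : 1 * (t * r') ≤ t * (t * r') := by gcongr
        linarith
      calc t * (r' * (γ * Q)) = γ * (t * r') * Q := by ring
        _ ≤ γ * (k₁ * (3 * k₂ + 1)) * Q := by gcongr
        _ ≤ _ := by gcongr
    have c2 : t * (r * (γ * (q * (Q / t)))) ≤ 2 * γ * R := by
      calc t * (r * (γ * (q * (Q / t)))) = r * (γ * (q * Q)) := by field_simp
        _ ≤ 2 * (γ * (1 * R)) := by gcongr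
        _ = _ := by ring
    have c3 : t * (β' * A₀) ≤ k₁ * (q + s + γ) * R := by
      have h1 : t * β' = (q + s) * R + γ * (q * (1 - q)) * (Q / t) := by
        rw [hβ']; field_simp; ring
      have h2 : Q / t ≤ R := hQt.trans (div_le_self hR0.le ht)
      have h3 : t * β' ≤ (q + s + γ) * R := by
        have : γ * (q * (1 - q)) * (Q / t) ≤ γ * 1 * R := by
          gcongr
        rw [h1]
        linarith
      calc t * (β' * A₀) = A₀ * (t * β') := by ring
        _ ≤ A₀ * ((q + s + γ) * R) := by gcongr
        _ ≤ k₁ * ((q + s + γ) * R) := by gcongr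
        _ = _ := by ring
    have c4 : t * (β * (A₁ + μ * (q * (Q / t)))) ≤ (k₁ * k₂ + k₁) * R := by
      calc t * (β * (A₁ + μ * (q * (Q / t)))) = β * (t * A₁ + q * A₀) := by
            rw [hA₀]; field_simp
        _ ≤ β * (k₁ * k₂ + k₁) := by
            have : 0 ≤ β := by linarith
            gcongr
            linarith
        _ ≤ R * (k₁ * k₂ + k₁) := by gcongr
        _ = _ := by ring
    -- Thus δ' = O(R/t), while β ≥ R/2; the threshold `ht3` on t then gives the factor a/2.
    have c5 : t * δ' ≤ (γ * (k₁ * (3 * k₂ + 1)) + 2 * γ + k₁ * (q + s + γ) + (k₁ * k₂ + k₁)) * R := by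
      rw [hδ']
      linarith
    have c6 : t * δ' ≤ t * (a / 2 * β) := by
      have : a * t * R ≤ a * t * (2 * β) := by gcongr; linarith
      have := mul_le_mul_of_nonneg_right ht3 hR0.le
      linarith
    exact le_of_mul_le_mul_left c6 ht0
  · have d1 : r * (γ * Q) ≤ 2 * (A₀ * S * Q) := by
      have : 0 ≤ r := by linarith
      gcongr
    have d2 : β * A₀ ≤ R * A₀ := by gcongr
    have d3 : R * A₀ = μ * Q ^ 2 * S := by rw [hA₀, hR]; ring
    have d4 : A₀ * S * Q = μ * Q ^ 2 * S := by rw [hA₀]; ring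
    rw [d4] at d1
    linarith

/-! ### Time-dependent coefficients and the reduced first-order form of the system. -/

lemma hasDerivAt_tderiv {E : Type*} [NormedAddCommGroup E] [NormedSpace ℝ E] {t₀ t : ℝ}
    {u : ℝ → E} (h : DifferentiableWithinAt ℝ u (Ici t₀) t) (ht : t₀ < t) :
    HasDerivAt u (tderiv t₀ u t) t :=
  h.hasDerivWithinAt.hasDerivAt (Ici_mem_nhds ht)

/-- The time scaling of the dual equation. -/
noncomputable def dualScale (γ q s t : ℝ) : ℝ := t ^ (q + s) - γ * q * t ^ (q - 1)

/-- The coefficient of the kinetic cross term. -/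
noncomputable def crossCoef (q t₀ : ℝ) (m : ℝ → ℝ) (t : ℝ) : ℝ :=
  1 - tderiv t₀ m t * t ^ q - q * (m t * t ^ (q - 1))

/-- The weight of the primal-dual gap in the Lyapunov function. -/
noncomputable def gapWeight (γ q s t₀ : ℝ) (m : ℝ → ℝ) (t : ℝ) : ℝ :=
  crossCoef q t₀ m t * (γ * t ^ q) + dualScale γ q s t * (m t * t ^ q)

/-- Explains the form of θ: the extrapolated velocity then enters the dual equation with weight
exactly δ, as needed to cancel the coupling in the Lyapunov derivative. -/
lemma extrap_eq (α γ q s t₀ : ℝ) (m : ℝ → ℝ) {t : ℝ} (ht : 0 < t) :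
    extrap α γ q s t₀ m t = gapWeight γ q s t₀ m t / ((α - 1) * dualScale γ q s t) := by
  have e1 : t ^ (2 * q) = t ^ q * t ^ q := by rw [two_mul, Real.rpow_add ht]
  have e2 : t ^ (2 * q + s) = t ^ q * t ^ q * t ^ s := by rw [Real.rpow_add ht, e1]
  have e3 : t ^ (2 * q - 1) = t ^ q * t ^ q / t := by rw [Real.rpow_sub_one ht.ne', e1]
  simp only [extrap, gapWeight, crossCoef, dualScale]
  congr 1
  rw [e1, e2, e3, Real.rpow_sub_one ht.ne', Real.rpow_add ht]
  field_simp
  ring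

lemma hasDerivAt_dualScale (γ q s : ℝ) {t : ℝ} (ht : 0 < t) :
    HasDerivAt (dualScale γ q s)
      ((q + s) * (t ^ q * t ^ s / t) - γ * q * ((q - 1) * (t ^ q / t / t))) t := by
  have h1 := Real.hasDerivAt_rpow_const (x := t) (p := q + s) (Or.inl ht.ne')
  have h2 := Real.hasDerivAt_rpow_const (x := t) (p := q - 1) (Or.inl ht.ne')
  refine (h1.sub (h2.const_mul (γ * q))).congr_deriv ?_
  rw [Real.rpow_sub_one ht.ne', Real.rpow_sub_one ht.ne', Real.rpow_sub_one ht.ne',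
    Real.rpow_add ht]

lemma hasDerivAt_crossCoef (q : ℝ) {t₀ t μ₁ μ₂ : ℝ} {m : ℝ → ℝ} (ht : 0 < t)
    (hm : HasDerivAt m μ₁ t) (hm1 : HasDerivAt (tderiv t₀ m) μ₂ t) :
    HasDerivAt (crossCoef q t₀ m) (-(μ₂ * t ^ q + tderiv t₀ m t * (q * (t ^ q / t)))
      - q * (μ₁ * (t ^ q / t) + m t * ((q - 1) * (t ^ q / t / t)))) t := by
  have h1 := Real.hasDerivAt_rpow_const (x := t) (p := q) (Or.inl ht.ne')
  have h2 := Real.hasDerivAt_rpow_const (x := t) (p := q - 1) (Or.inl ht.ne')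
  refine (((hm1.mul h1).const_sub 1).sub ((hm.mul h2).const_mul q)).congr_deriv ?_
  rw [Real.rpow_sub_one ht.ne', Real.rpow_sub_one ht.ne', Real.rpow_sub_one ht.ne']

lemma hasDerivAt_gapWeight {γ q s t₀ t μ₁ r' β' : ℝ} {m : ℝ → ℝ} (ht : 0 < t)
    (hm : HasDerivAt m μ₁ t) (hr : HasDerivAt (crossCoef q t₀ m) r' t)
    (hβ : HasDerivAt (dualScale γ q s) β' t) :
    HasDerivAt (gapWeight γ q s t₀ m) (r' * (γ * t ^ q)
      + crossCoef q t₀ m t * (γ * (q * (t ^ q / t))) + (β' * (m t * t ^ q)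
      + dualScale γ q s t * (μ₁ * t ^ q + m t * (q * (t ^ q / t))))) t := by
  have h1 := Real.hasDerivAt_rpow_const (x := t) (p := q) (Or.inl ht.ne')
  refine ((hr.mul (h1.const_mul γ)).add (hβ.mul (hm.mul h1))).congr_deriv ?_
  rw [Real.rpow_sub_one ht.ne', Pi.mul_apply]

lemma hasDerivAt_const_div_rpow (c p : ℝ) {t : ℝ} (ht : 0 < t) :
    HasDerivAt (fun z : ℝ => c / z ^ p) (-(p * c / t ^ p / t)) t := by
  have h1 := Real.hasDerivAt_rpow_const (x := t) (p := p) (Or.inl ht.ne')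
  have h0 : t ^ p ≠ 0 := (Real.rpow_pos_of_pos ht p).ne'
  refine ((hasDerivAt_const t c).div h1 h0).congr_deriv ?_
  rw [Real.rpow_sub_one ht.ne']
  field_simp
  ring

section System

variable {X Y : Type*} [NormedAddCommGroup X] [InnerProductSpace ℝ X] [CompleteSpace X]
  [NormedAddCommGroup Y] [InnerProductSpace ℝ Y] [CompleteSpace Y]
  {f : X → ℝ} {A : X →L[ℝ] Y} {b : Y} {α γ c p q s t₀ : ℝ} {m : ℝ → ℝ} {x : ℝ → X} {l : ℝ → Y}

/-- The velocity part of the Lyapunov function. -/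
noncomputable def velocity (f : X → ℝ) (A : X →L[ℝ] Y) (b : Y) (γ c p q t₀ : ℝ) (m : ℝ → ℝ)
    (x : ℝ → X) (l : ℝ → Y) (t : ℝ) : X :=
  (m t * t ^ q) • tderiv t₀ x t + (γ * t ^ q) • gradPrimal f A b c p t (x t) (l t)

/-- Multiplying the primal equation by t^q eliminates both the acceleration and the derivative of
the gradient, leaving only ẋ and the gradient itself. -/
lemma IsGlobalSolution.hasDerivAt_velocity (h : IsGlobalSolution f A b α γ c p q s t₀ m x l)
    {t : ℝ} (ht : 0 < t) (ht₀ : t₀ < t) (hm : HasDerivAt m (tderiv t₀ m t) t) :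
    HasDerivAt (velocity f A b γ c p q t₀ m x l)
      (-((crossCoef q t₀ m t + (α - 1)) • tderiv t₀ x t)
        - dualScale γ q s t • gradPrimal f A b c p t (x t) (l t)) t := by
  have hq := Real.hasDerivAt_rpow_const (x := t) (p := q) (Or.inl ht.ne')
  have hdx := hasDerivAt_tderiv (h.diff_dx t ht₀.le) ht₀
  have hdg := hasDerivAt_tderiv (h.diff_grad t ht₀.le) ht₀
  have hp := h.primal_eq t ht₀.le
  have hQ : t ^ q ≠ 0 := (Real.rpow_pos_of_pos ht q).ne'
  refine (((hm.mul hq).smul hdx).add ((hq.const_mul γ).smul hdg)).congr_deriv ?_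
  rw [← sub_eq_zero, ← smul_zero (t ^ q), ← hp]
  simp only [crossCoef, dualScale, Real.rpow_add ht, Pi.mul_apply]
  match_scalars <;> field_simp <;> ring

lemma IsGlobalSolution.tderiv_dual_eq (h : IsGlobalSolution f A b α γ c p q s t₀ m x l)
    {t : ℝ} (ht : 0 < t) (ht₀ : t₀ ≤ t) (hα : α - 1 ≠ 0) (hβ : dualScale γ q s t ≠ 0) :
    tderiv t₀ l t = ((α - 1) * dualScale γ q s t) • (A (x t) - b - (c / t ^ p) • l t)
      + gapWeight γ q s t₀ m t • A (tderiv t₀ x t) := by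
  have hd := h.dual_eq t ht₀
  rw [gradDual_eq, extrap_eq α γ q s t₀ m ht, map_add, map_smul, sub_eq_zero] at hd
  rw [hd]
  change ((α - 1) * dualScale γ q s t) • _ = _
  match_scalars <;> field_simp

end System

/-! ### Modulus of continuity of the saddle path. -/

section Curve

variable {X Y : Type*} [NormedAddCommGroup X] [InnerProductSpace ℝ X] [CompleteSpace X]
  [NormedAddCommGroup Y] [InnerProductSpace ℝ Y] [CompleteSpace Y]
  {f : X → ℝ} {A : X →L[ℝ] Y} {b : Y} {c p t₀ : ℝ} {xt : ℝ → X} {lt : ℝ → Y} {xs : X} {ls : Y}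

lemma norm_fst_le_pairNorm {X Y : Type*} [NormedAddCommGroup X] [InnerProductSpace ℝ X]
    [NormedAddCommGroup Y] [InnerProductSpace ℝ Y] (x : X) (l : Y) : ‖x‖ ≤ pairNorm x l := by
  refine le_of_sq_le_sq ?_ (pairNorm_nonneg x l)
  rw [pairNorm_sq]
  nlinarith [sq_nonneg ‖l‖]

lemma norm_snd_le_pairNorm {X Y : Type*} [NormedAddCommGroup X] [InnerProductSpace ℝ X]
    [NormedAddCommGroup Y] [InnerProductSpace ℝ Y] (x : X) (l : Y) : ‖l‖ ≤ pairNorm x l := by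
  refine le_of_sq_le_sq ?_ (pairNorm_nonneg x l)
  rw [pairNorm_sq]
  nlinarith [sq_nonneg ‖x‖]

/-- The ratio of the weights c/t^p and c/z^p is (z/t)^p. The bound is differentiable in z and
vanishes at z = t, so it serves as the majorant ω. -/
lemma pairNorm_curve_sub_le (hf : Differentiable ℝ f) (hconv : ConvexOn ℝ univ f)
    (hc : 0 < c) (hp : 0 < p) (ht₀ : 0 < t₀)
    (hsad : ∀ t ∈ Ici t₀, IsSaddlePt (tikhonov f A b (c / t ^ p)) (xt t) (lt t))
    (hs : IsSaddlePt (lagrangian f A b) xs ls) {t z : ℝ} (ht : t₀ ≤ t) (htz : t ≤ z) :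
    pairNorm (xt z - xt t) (lt z - lt t) ≤ ((z / t) ^ p - 1) * pairNorm xs ls := by
  have ht0 : 0 < t := ht₀.trans_le ht
  have hz0 : 0 < z := ht0.trans_le htz
  have hD := Real.rpow_pos_of_pos ht0 p
  have hD' := Real.rpow_pos_of_pos hz0 p
  have hle : t ^ p ≤ z ^ p := Real.rpow_le_rpow ht0.le htz hp.le
  have h1 := pairNorm_sub_le_of_saddle hf hconv (div_pos hc hD')
    (div_le_div_of_nonneg_left hc.le hD hle) (hsad t ht) (hsad z (ht.trans htz))
  have h2 := pairNorm_le_of_saddle hf hconv (div_pos hc hD) (hsad t ht) hs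
  have e : c / t ^ p / (c / z ^ p) = (z / t) ^ p := by
    rw [Real.div_rpow hz0.le ht0.le]; field_simp
  rw [e] at h1
  refine h1.trans ?_
  have : 0 ≤ (z / t) ^ p - 1 := by
    rw [Real.div_rpow hz0.le ht0.le, sub_nonneg, one_le_div hD]
    exact hle
  gcongr

lemma continuousOn_curve (hf : Differentiable ℝ f) (hconv : ConvexOn ℝ univ f)
    (hc : 0 < c) (hp : 0 < p) (ht₀ : 0 < t₀)
    (hsad : ∀ t ∈ Ici t₀, IsSaddlePt (tikhonov f A b (c / t ^ p)) (xt t) (lt t))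
    (hs : IsSaddlePt (lagrangian f A b) xs ls) :
    ContinuousOn xt (Ici t₀) ∧ ContinuousOn lt (Ici t₀) := by
  have key : ∀ t ∈ Ici t₀, ∀ z ∈ Ici t₀, pairNorm (xt z - xt t) (lt z - lt t) ≤
      (|(z / t) ^ p - 1| + |(t / z) ^ p - 1|) * pairNorm xs ls := by
    intro t ht z hz
    have hW := pairNorm_nonneg xs ls
    rcases le_total t z with h | h
    · refine (pairNorm_curve_sub_le hf hconv hc hp ht₀ hsad hs ht h).trans ?_
      gcongr
      linarith [le_abs_self ((z / t) ^ p - 1), abs_nonneg ((t / z) ^ p - 1)]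
    · have h1 := pairNorm_curve_sub_le hf hconv hc hp ht₀ hsad hs hz h
      have e : pairNorm (xt z - xt t) (lt z - lt t) = pairNorm (xt t - xt z) (lt t - lt z) := by
        refine (pow_left_inj₀ (pairNorm_nonneg _ _) (pairNorm_nonneg _ _) two_ne_zero).1 ?_
        rw [pairNorm_sq, pairNorm_sq, norm_sub_rev, norm_sub_rev (lt z)]
      rw [e]
      refine h1.trans ?_
      gcongr
      linarith [le_abs_self ((t / z) ^ p - 1), abs_nonneg ((z / t) ^ p - 1)]
  have lim : ∀ t ∈ Ici t₀, Tendsto (fun z =>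
      (|(z / t) ^ p - 1| + |(t / z) ^ p - 1|) * pairNorm xs ls) (𝓝[Ici t₀] t) (𝓝 0) := by
    intro t ht
    have ht0 : 0 < t := ht₀.trans_le ht
    have h1 : ContinuousAt (fun z : ℝ =>
        (|(z / t) ^ p - 1| + |(t / z) ^ p - 1|) * pairNorm xs ls) t := by
      have c1 : ContinuousAt (fun z : ℝ => (z / t) ^ p) t :=
        (continuousAt_id.div_const t).rpow_const (Or.inr hp.le)
      have c2 : ContinuousAt (fun z : ℝ => (t / z) ^ p) t :=
        (continuousAt_const.div continuousAt_id ht0.ne').rpow_const (Or.inr hp.le)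
      exact ((c1.sub_const 1).abs.add (c2.sub_const 1).abs).mul_const _
    have h2 := h1.tendsto.mono_left (nhdsWithin_le_nhds (s := Ici t₀))
    simpa [div_self ht0.ne'] using h2
  constructor
  · intro t ht
    rw [ContinuousWithinAt, tendsto_iff_norm_sub_tendsto_zero]
    refine squeeze_zero' (Eventually.of_forall fun _ => norm_nonneg _) ?_ (lim t ht)
    filter_upwards [self_mem_nhdsWithin] with z hz
    exact (norm_fst_le_pairNorm _ _).trans (key t ht z hz)
  · intro t ht
    rw [ContinuousWithinAt, tendsto_iff_norm_sub_tendsto_zero]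
    refine squeeze_zero' (Eventually.of_forall fun _ => norm_nonneg _) ?_ (lim t ht)
    filter_upwards [self_mem_nhdsWithin] with z hz
    exact (norm_snd_le_pairNorm _ _).trans (key t ht z hz)

end Curve

lemma norm_add_sq_le_three {H : Type*} [NormedAddCommGroup H] [InnerProductSpace ℝ H]
    {a M Γ : ℝ} (ha : 0 ≤ a) (hM : 0 ≤ M) (hΓ : 0 ≤ Γ) (u v g : H) :
    ‖a • u + (M • v + Γ • g)‖ ^ 2 ≤
      3 * (a ^ 2 * ‖u‖ ^ 2 + M ^ 2 * ‖v‖ ^ 2 + Γ ^ 2 * ‖g‖ ^ 2) := by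
  have h : ‖a • u + (M • v + Γ • g)‖ ≤ a * ‖u‖ + M * ‖v‖ + Γ * ‖g‖ := by
    refine (norm_add_le _ _).trans ?_
    have := norm_add_le (M • v) (Γ • g)
    rw [norm_smul, norm_smul, Real.norm_of_nonneg hM, Real.norm_of_nonneg hΓ] at this
    rw [norm_smul, Real.norm_of_nonneg ha]
    linarith
  have h2 := pow_le_pow_left₀ (norm_nonneg _) h 2
  nlinarith [sq_nonneg (a * ‖u‖ - M * ‖v‖), sq_nonneg (a * ‖u‖ - Γ * ‖g‖),
    sq_nonneg (M * ‖v‖ - Γ * ‖g‖)]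

/-- Produces a single contraction constant a₀ meeting all the smallness conditions of the absorption
step. -/
lemma exists_pos_mul_le {ι : Type*} [Finite ι] (u v : ι → ℝ) (hv : ∀ i, 0 < v i) :
    ∃ a : ℝ, 0 < a ∧ ∀ i, a * u i ≤ v i := by
  have h : ∀ᶠ a : ℝ in 𝓝[>] 0, ∀ i, a * u i ≤ v i := by
    rw [eventually_all]
    intro i
    have h1 : Tendsto (fun a : ℝ => a * u i) (𝓝[>] 0) (𝓝 0) := by
      have : Continuous fun a : ℝ => a * u i := by fun_prop
      simpa using (this.tendsto 0).mono_left nhdsWithin_le_nhds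
    exact (h1.eventually_lt_const (hv i)).mono fun _ h => h.le
  obtain ⟨a, h1, h2⟩ := (h.and self_mem_nhdsWithin).exists
  exact ⟨a, h2, h1⟩

/-- The estimates for the mass and the derived coefficients that hold at all large times. -/
structure CoefBounds (a γ c p q s t₀ k₁ k₂ : ℝ) (m : ℝ → ℝ) (t : ℝ) : Prop where
  one_le : 1 ≤ t
  gt : t₀ < t
  mass_pos : 0 < m t
  mass_deriv : HasDerivAt m (tderiv t₀ m t) t
  mass_le : m t * t ^ q ≤ k₁
  le_mass : γ ≤ m t * t ^ q * t ^ s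
  mass_deriv_le : t * |tderiv t₀ m t| ≤ k₂ * m t
  le_scale : t ^ q * t ^ s / 2 ≤ dualScale γ q s t
  le_cross : 1 / 2 ≤ crossCoef q t₀ m t
  cross_le : crossCoef q t₀ m t ≤ 2
  gap_nonneg : 0 ≤ gapWeight γ q s t₀ m t
  gap_le : gapWeight γ q s t₀ m t ≤ 3 * (m t * (t ^ q) ^ 2 * t ^ s)
  cross_deriv : ∃ r', HasDerivAt (crossCoef q t₀ m) r' t ∧ r' ≤ dualScale γ q s t * (c / t ^ p) / 8
  gap_deriv : ∃ δ', HasDerivAt (gapWeight γ q s t₀ m) δ' t ∧ δ' ≤ a / 2 * dualScale γ q s t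

lemma eventually_coefBounds {a γ c p q s t₀ : ℝ} {m : ℝ → ℝ} (ha : 0 < a) (hγ : 0 < γ)
    (hc : 0 < c) (hq0 : 0 < q) (hq1 : q < 1) (hs : 0 < s) (hpqs : p - q - s ≤ 1)
    (hm : IsMass t₀ m) (hm1 : MassBounds γ q s m) (hm2 : MassDerivBounds t₀ m) :
    ∃ k₁ k₂ : ℝ, 0 < k₁ ∧ 0 < k₂ ∧ ∀ᶠ t in atTop, CoefBounds a γ c p q s t₀ k₁ k₂ m t := by
  obtain ⟨k₁, hk₁, h1⟩ := hm1
  obtain ⟨k₂, hk₂, h2⟩ := hm2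
  refine ⟨k₁, k₂, hk₁, hk₂, ?_⟩
  filter_upwards [h1, h2, eventually_ge_atTop 1, eventually_gt_atTop t₀,
    eventually_ge_atTop (2 * γ), eventually_ge_atTop (2 * (k₁ * k₂ + k₁)),
    eventually_ge_atTop (4 * (γ * (k₁ * (3 * k₂ + 1)) + 2 * γ + k₁ * (q + s + γ)
      + (k₁ * k₂ + k₁)) / a), eventually_ge_atTop (16 * (k₁ * (3 * k₂ + 1)) / c)] with
    t hb hd ht1 ht₀ e1 e2 e3 e4
  have ht : 0 < t := by linarith
  have hμ := hm.pos t ht₀.le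
  have hQ : 1 ≤ t ^ q := Real.one_le_rpow ht1 hq0.le
  have hS : 1 ≤ t ^ s := Real.one_le_rpow ht1 hs.le
  have hQ0 : 0 < t ^ q := by linarith
  have hS0 : 0 < t ^ s := by linarith
  have hD0 : 0 < t ^ p := Real.rpow_pos_of_pos ht p
  have hmd := hasDerivAt_tderiv (hm.diff t ht₀.le) ht₀
  have hmd1 := hasDerivAt_tderiv hd.1 ht₀
  have hβd := hasDerivAt_dualScale γ q s ht
  have hrd := hasDerivAt_crossCoef q ht hmd hmd1
  have hδd := hasDerivAt_gapWeight ht hmd hrd hβd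
  have hμ1 : m t * t ^ q ≤ k₁ := (le_div_iff₀ hQ0).1 hb.2
  have hμ2 : γ ≤ m t * t ^ q * t ^ s := by
    have := hb.1
    rw [div_le_iff₀ (Real.rpow_pos_of_pos ht _), Real.rpow_add ht] at this
    linarith
  rw [div_le_iff₀' ha] at e3
  rw [div_le_iff₀' hc] at e4
  obtain ⟨b1, -, b3, b4, b5, b6, b7⟩ := coef_bounds hγ hq0 hq1 hs hk₂ ha ht1 hQ hS hμ hμ1 hμ2 hd.2.1
    hd.2.2 (β := dualScale γ q s t) (r := crossCoef q t₀ m t)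
    (by rw [dualScale, Real.rpow_add ht, Real.rpow_sub_one ht.ne']) rfl
    (by rw [crossCoef, Real.rpow_sub_one ht.ne']) rfl rfl e1 e2 e3
  have hβ : 0 < dualScale γ q s t := lt_of_lt_of_le (by positivity) b1
  refine ⟨ht1, ht₀, hμ, hmd, hμ1, hμ2, hd.2.1, b1, b3, b4, ?_, b7, ⟨_, hrd, ?_⟩, ⟨_, hδd, b6⟩⟩
  · have : 0 < crossCoef q t₀ m t := by linarith
    unfold gapWeight
    positivity
  -- Here r' is bounded above by a constant over t², whereas βε ≥ (c/2) t^(q+s−p) ≥ (c/2)/t because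
  -- p − q − s ≤ 1.
  · have h3 : 1 / t ≤ t ^ q * t ^ s / t ^ p := by
      rw [← Real.rpow_add ht, ← Real.rpow_sub ht, one_div, ← Real.rpow_neg_one]
      exact Real.rpow_le_rpow_of_exponent_le ht1 (by linarith)
    have h4 : c / 2 * (t ^ q * t ^ s / t ^ p) ≤ dualScale γ q s t * (c / t ^ p) := by
      calc c / 2 * (t ^ q * t ^ s / t ^ p) = t ^ q * t ^ s / 2 * (c / t ^ p) := by ring
        _ ≤ _ := by gcongr
    refine le_of_mul_le_mul_left (b5.trans ?_) (pow_pos ht 2)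
    have h5 : t ^ 2 * (c / 2 * (1 / t) / 8) ≤ t ^ 2 * (dualScale γ q s t * (c / t ^ p) / 8) := by
      have : c / 2 * (1 / t) ≤ c / 2 * (t ^ q * t ^ s / t ^ p) := by gcongr
      have := this.trans h4
      gcongr
    refine le_trans ?_ h5
    have : t ^ 2 * (c / 2 * (1 / t) / 8) = c * t / 16 := by field_simp; norm_num
    rw [this]
    linarith

lemma tikhonov_gap_nonneg {X Y : Type*} [NormedAddCommGroup X] [InnerProductSpace ℝ X]
    [NormedAddCommGroup Y] [InnerProductSpace ℝ Y] {f : X → ℝ} {A : X →L[ℝ] Y} {b : Y} {ε : ℝ} {x₀ : X} {l₀ : Y}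
    (h : IsSaddlePt (tikhonov f A b ε) x₀ l₀) (x : X) :
    0 ≤ tikhonov f A b ε x l₀ - tikhonov f A b ε x₀ l₀ :=
  sub_nonneg.2 (h x l₀).2

/-! ### Decay of the energy along solutions. -/

section Decay

variable {X Y : Type*} [NormedAddCommGroup X] [InnerProductSpace ℝ X] [CompleteSpace X]
  [NormedAddCommGroup Y] [InnerProductSpace ℝ Y] [CompleteSpace Y]
  {f : X → ℝ} {A : X →L[ℝ] Y} {b : Y} {α γ c p q s t₀ k₁ k₂ : ℝ} {m : ℝ → ℝ} {x : ℝ → X}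
  {l : ℝ → Y} {xt : ℝ → X} {lt : ℝ → Y} {xs : X} {ls : Y}

/-- The Lyapunov function of the system. -/
noncomputable def energy (f : X → ℝ) (A : X →L[ℝ] Y) (b : Y) (α γ c p q s t₀ : ℝ) (m : ℝ → ℝ)
    (x : ℝ → X) (l : ℝ → Y) (xt : ℝ → X) (lt : ℝ → Y) : ℝ → ℝ :=
  lyapunov f A b (α - 1) (fun t => c / t ^ p) (gapWeight γ q s t₀ m) (crossCoef q t₀ m) x
    (velocity f A b γ c p q t₀ m x l) l xt lt

lemma le_energy (hα : 1 < α) {t : ℝ} (hb : CoefBounds (α - 1) γ c p q s t₀ k₁ k₂ m t)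
    (hsad : IsSaddlePt (tikhonov f A b (c / t ^ p)) (xt t) (lt t)) :
    (α - 1) / 4 * ‖x t - xt t‖ ^ 2 + 1 / 2 * ‖l t - lt t‖ ^ 2
      ≤ energy f A b α γ c p q s t₀ m x l xt lt t := by
  have h1 := mul_nonneg hb.gap_nonneg (tikhonov_gap_nonneg hsad (x t))
  have h2 : (1 / 2) * ((α - 1) / 2) * ‖x t - xt t‖ ^ 2
      ≤ crossCoef q t₀ m t * ((α - 1) / 2) * ‖x t - xt t‖ ^ 2 := by
    have : 0 ≤ (α - 1) / 2 := by linarith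
    have := hb.le_cross
    gcongr
  simp only [energy, lyapunov]
  have h3 := sq_nonneg ‖(α - 1) • (x t - xt t) + velocity f A b γ c p q t₀ m x l t‖
  linarith

lemma continuousOn_energy (hf : Differentiable ℝ f) (hconv : ConvexOn ℝ univ f) (hc : 0 < c)
    (hp : 0 < p) (ht₀ : 0 < t₀) (hsol : IsGlobalSolution f A b α γ c p q s t₀ m x l)
    (hsad : ∀ t ∈ Ici t₀, IsSaddlePt (tikhonov f A b (c / t ^ p)) (xt t) (lt t))
    (hs : IsSaddlePt (lagrangian f A b) xs ls) {T : ℝ}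
    (hT : ∀ t ∈ Ici T, CoefBounds (α - 1) γ c p q s t₀ k₁ k₂ m t) :
    ContinuousOn (energy f A b α γ c p q s t₀ m x l xt lt) (Ici T) := by
  have hsub : Ici T ⊆ Ici t₀ := fun t ht => (hT t ht).gt.le
  have hpos : ∀ t ∈ Ici T, 0 < t := fun t ht => one_pos.trans_le (hT t ht).one_le
  obtain ⟨cx', cl'⟩ := continuousOn_curve hf hconv hc hp ht₀ hsad hs
  have cxt := cx'.mono hsub
  have clt := cl'.mono hsub
  have cx := hsol.diff_x.continuousOn.mono hsub
  have cl := hsol.diff_l.continuousOn.mono hsub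
  have cε : ContinuousOn (fun t : ℝ => c / t ^ p) (Ici T) := fun t ht =>
    (hasDerivAt_const_div_rpow c p (hpos t ht)).continuousAt.continuousWithinAt
  have cδ : ContinuousOn (gapWeight γ q s t₀ m) (Ici T) := fun t ht => by
    obtain ⟨_, h, -⟩ := (hT t ht).gap_deriv
    exact h.continuousAt.continuousWithinAt
  have cr : ContinuousOn (crossCoef q t₀ m) (Ici T) := fun t ht => by
    obtain ⟨_, h, -⟩ := (hT t ht).cross_deriv
    exact h.continuousAt.continuousWithinAt
  have cV : ContinuousOn (velocity f A b γ c p q t₀ m x l) (Ici T) := fun t ht =>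
    (hsol.hasDerivAt_velocity (hpos t ht) (hT t ht).gt
      (hT t ht).mass_deriv).continuousAt.continuousWithinAt
  have hfc := hf.continuous
  have ctik : ∀ u : ℝ → X, ContinuousOn u (Ici T) →
      ContinuousOn (fun t => tikhonov f A b (c / t ^ p) (u t) (lt t)) (Ici T) := fun u cu =>
    ((hfc.comp_continuousOn cu).add
      (clt.inner ((A.continuous.comp_continuousOn cu).sub continuousOn_const))).add
      ((cε.div_const 2).mul ((cu.norm.pow 2).sub (clt.norm.pow 2)))
  exact (((cδ.mul ((ctik x cx).sub (ctik xt cxt))).add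
    (continuousOn_const.mul ((((cx.sub cxt).const_smul (α - 1)).add cV).norm.pow 2))).add
    ((cr.mul continuousOn_const).mul ((cx.sub cxt).norm.pow 2))).add
    (continuousOn_const.mul ((cl.sub clt).norm.pow 2))

/-- The upper right Dini derivative of the energy is at most `-ν E` plus a residual term. -/
lemma eventually_slope_energy_lt (hf : Differentiable ℝ f) (hconv : ConvexOn ℝ univ f)
    (hα : 1 < α) (hγ : 0 < γ) (hc : 0 < c) (hp : 0 < p) (ht₀ : 0 < t₀)
    (hq0 : 0 < q) (hs0 : 0 < s)
    (hsol : IsGlobalSolution f A b α γ c p q s t₀ m x l)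
    (hsad : ∀ t ∈ Ici t₀, IsSaddlePt (tikhonov f A b (c / t ^ p)) (xt t) (lt t))
    (hs : IsSaddlePt (lagrangian f A b) xs ls) {T : ℝ}
    (hT : ∀ t ∈ Ici T, CoefBounds (α - 1) γ c p q s t₀ k₁ k₂ m t) {a₀ κ : ℝ} (ha₀ : 0 < a₀)
    (hκ0 : 0 ≤ κ) (hκ : p - q - s ≤ κ)
    (n1 : a₀ * (6 * k₁) ≤ (α - 1) / 2)
    (n2 : a₀ * (2 / c * (3 / 2 * (α - 1) ^ 2 + (α - 1))) ≤ (α - 1) / 4)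
    (n3 : a₀ * (3 / 2 * k₁) ≤ 1 / 4) (n4 : a₀ * (3 * γ) ≤ 1 / 2) (n5 : a₀ * (1 / c) ≤ (α - 1) / 2)
    {n w K : ℝ} (hw : w = p * pairNorm xs ls) (hn : n = p * c * pairNorm xs ls + w * ‖A‖)
    (hK : K = 72 * n ^ 2 * k₁ / ((α - 1) * c)
      + (4 * (α - 1) ^ 3 + 16 * (α - 1) + 1 / (2 * (α - 1))) * (2 * w ^ 2 / (c * γ))
      + (α - 1) ^ 2 * w ^ 2 + (α - 1) ^ 2 * w ^ 2) {t : ℝ} (ht : t ∈ Ici T) {ρ : ℝ}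
    (hρ : -(a₀ * t ^ (-κ)) * energy f A b α γ c p q s t₀ m x l xt lt t
      + K * (t ^ (-κ) * (m t * t ^ (3 * q + s + p - 2 + κ))) < ρ) :
    ∀ᶠ z in 𝓝[>] t, slope (energy f A b α γ c p q s t₀ m x l xt lt) t z < ρ := by
  have hb := hT t ht
  have ha : 0 < α - 1 := by linarith
  have ht1 := hb.one_le
  have ht0 : 0 < t := by linarith
  have htt : t ∈ Ici t₀ := hb.gt.le
  have hW := pairNorm_nonneg xs ls
  have hw0 : 0 ≤ w := by rw [hw]; positivity
  have hQ : 1 ≤ t ^ q := Real.one_le_rpow ht1 hq0.le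
  have hS : 1 ≤ t ^ s := Real.one_le_rpow ht1 hs0.le
  have hD : 1 ≤ t ^ p := Real.one_le_rpow ht1 hp.le
  have hQ0 : 0 < t ^ q := by linarith
  have hS0 : 0 < t ^ s := by linarith
  have hD0 : 0 < t ^ p := by linarith
  have hμ := hb.mass_pos
  have hβ : 0 < dualScale γ q s t := lt_of_lt_of_le (by positivity) hb.le_scale
  obtain ⟨r', hr', hr'le⟩ := hb.cross_deriv
  obtain ⟨δ', hδ', hδ'le⟩ := hb.gap_deriv
  have hx := hasDerivAt_tderiv (hsol.diff_x t htt) hb.gt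
  have hl := hasDerivAt_tderiv (hsol.diff_l t htt) hb.gt
  have hV := hsol.hasDerivAt_velocity ht0 hb.gt hb.mass_deriv
  have hl' := hsol.tderiv_dual_eq ht0 htt ha.ne' hβ.ne'
  have hsadt := hsad t htt
  have hxtW : ‖xt t‖ ≤ pairNorm xs ls := (norm_fst_le_pairNorm _ (lt t)).trans
    (pairNorm_le_of_saddle hf hconv (div_pos hc hD0) hsadt hs)
  have hω : HasDerivAt (fun z : ℝ => ((z / t) ^ p - 1) * pairNorm xs ls) (w / t) t := by
    have h1 : HasDerivAt (fun z : ℝ => (z / t) ^ p) (1 / t * p * (t / t) ^ (p - 1)) t :=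
      ((hasDerivAt_id t).div_const t).rpow_const (Or.inl (by simp [ht0.ne']))
    refine ((h1.sub_const 1).mul_const _).congr_deriv ?_
    rw [div_self ht0.ne', Real.one_rpow, hw]
    ring
  have hcurve : ∀ z, t ≤ z → pairNorm (xt z - xt t) (lt z - lt t)
      ≤ ((z / t) ^ p - 1) * pairNorm xs ls := fun z hz =>
    pairNorm_curve_sub_le hf hconv hc hp ht₀ hsad hs htt hz
  refine eventually_slope_lyapunov_lt hf ha.le (hasDerivAt_const_div_rpow c p ht0) hδ' hr' hω
    (by simp [div_self ht0.ne']) hx hV hl (fun z hz => hsad z (le_trans htt hz))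
    (fun z hz => (div_pos hc (Real.rpow_pos_of_pos (ht0.trans_le hz) p)).le)
    (fun z hz => div_le_div_of_nonneg_left hc.le hD0 (Real.rpow_le_rpow ht0.le hz hp.le))
    (fun z hz => (hT z (le_trans ht hz)).gap_nonneg)
    (fun z hz => le_trans (by norm_num) (hT z (le_trans ht hz)).le_cross)
    (fun z hz => (norm_fst_le_pairNorm _ _).trans (hcurve z hz))
    (fun z hz => (norm_snd_le_pairNorm _ _).trans (hcurve z hz)) (lt_of_le_of_lt ?_ hρ)
  set M := m t * t ^ q with hM
  set Γ := γ * t ^ q with hΓ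
  set ε := c / t ^ p with hε
  set β := dualScale γ q s t with hβdef
  set P := β * ε with hP
  set σ := t ^ (-κ) with hσ
  set G := tikhonov f A b ε (x t) (lt t) - tikhonov f A b ε (xt t) (lt t) with hG
  have hε0 : 0 < ε := div_pos hc hD0
  have hM0 : 0 < M := by positivity
  have hΓ0 : 0 < Γ := by positivity
  have hP0 : 0 < P := by positivity
  have hσ0 : 0 < σ := Real.rpow_pos_of_pos ht0 _
  have hσ1 : σ ≤ 1 := Real.rpow_le_one_of_one_le_of_nonpos ht1 (by linarith)
  have hPlb : c / 2 * (t ^ q * t ^ s / t ^ p) ≤ P := by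
    calc c / 2 * (t ^ q * t ^ s / t ^ p) = t ^ q * t ^ s / 2 * ε := by rw [hε]; ring
      _ ≤ _ := by rw [hP]; gcongr; exact hb.le_scale
  -- The only use of p − q − s ≤ κ: the contraction rate must not exceed the dissipation P = βε.
  have hσP : σ ≤ 2 / c * P := by
    have h1 : σ ≤ t ^ q * t ^ s / t ^ p := by
      rw [← Real.rpow_add ht0, ← Real.rpow_sub ht0]
      exact Real.rpow_le_rpow_of_exponent_le ht1 (by linarith)
    have h2 : 2 / c * (c / 2 * (t ^ q * t ^ s / t ^ p)) ≤ 2 / c * P := by gcongr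
    have h3 : 2 / c * (c / 2 * (t ^ q * t ^ s / t ^ p)) = t ^ q * t ^ s / t ^ p := by field_simp
    linarith
  have hk₁ : 0 < k₁ := hM0.trans_le hb.mass_le
  have main := dini_lyapunov_le hf hconv (δ' := δ') (r' := r') ha.le hβ.le hM0.le hΓ0.le
    (show -(p * c / t ^ p / t) ≤ 0 by rw [neg_nonpos]; positivity) (show 0 ≤ w / t by positivity)
    (gradPrimal_eq hf A b c p t (x t) (l t)) rfl rfl hl' rfl hb.gap_nonneg hsadt
  refine main.trans ?_
  have habs := absorption (a := α - 1) (P := P) (β := β) (r := crossCoef q t₀ m t) (M := M)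
    (Γ := Γ) (δ := gapWeight γ q s t₀ m t) (δ' := δ') (r' := r') (ω' := w / t)
    (N := -(-(p * c / t ^ p / t)) * ‖xt t‖ + w / t * ‖A‖) (ν := a₀ * σ) (G := G)
    (E := energy f A b α γ c p q s t₀ m x l xt lt t) (X := ‖x t - xt t‖)
    (Λ := ‖l t - lt t‖) (U := ‖tderiv t₀ x t‖) (g := ‖gradPrimal f A b c p t (x t) (l t)‖)
    ha hP0 hβ hM0.le hΓ0.le hb.le_cross hb.cross_le (by positivity)
    (tikhonov_gap_nonneg hsadt (x t)) (norm_nonneg _) (by positivity) hδ'le hr'le ?_ ?_ ?_ ?_ ?_ ?_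
  · have hres := residual_le (a := α - 1) (P := P) (β := β) (M := M) (Γ := Γ)
      (δ := gapWeight γ q s t₀ m t) (ω' := w / t)
      (N := -(-(p * c / t ^ p / t)) * ‖xt t‖ + w / t * ‖A‖) (t := t) (Q := t ^ q) (S := t ^ s)
      (D := t ^ p) (μ := m t) (k₁ := k₁) (c := c) (γ := γ) (n := n) (w := w) ha hγ hc ht1 hQ hS hD
      hμ hb.mass_le hb.le_mass hPlb hb.le_scale rfl rfl hb.gap_nonneg hb.gap_le
      (by rw [neg_neg]; positivity) ?_ rfl
    · rw [← hK] at hres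
      -- The factor t^(−κ) is extracted so that the source has the form required by the comparison
      -- lemma, which puts t^κ into Φ.
      have hpow : (t ^ q) ^ 3 * t ^ s * t ^ p / t ^ 2 = σ * t ^ (3 * q + s + p - 2 + κ) := by
        rw [hσ, ← Real.rpow_natCast (t ^ q) 3, ← Real.rpow_mul ht0.le, ← Real.rpow_natCast t 2,
          ← Real.rpow_add ht0, ← Real.rpow_add ht0, ← Real.rpow_sub ht0, ← Real.rpow_add ht0]
        congr 1
        push_cast
        ring
      rw [hpow] at hres
      have e1 : (α - 1) * β * (ε / 2) * ‖x t - xt t‖ ^ 2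
          = (α - 1) * (P / 2) * ‖x t - xt t‖ ^ 2 := by rw [hP]; ring
      have e2 : (α - 1) * β * ε * ‖l t - lt t‖ ^ 2 = (α - 1) * P * ‖l t - lt t‖ ^ 2 := by
        rw [hP]; ring
      have e3 : K * (m t * (σ * t ^ (3 * q + s + p - 2 + κ)))
          = K * (σ * (m t * t ^ (3 * q + s + p - 2 + κ))) := by ring
      rw [e1, e2]
      rw [e3] at hres
      linarith
    · rw [hn, neg_neg]
      have : p * c / t ^ p / t * ‖xt t‖ ≤ p * c / 1 / t * pairNorm xs ls := by gcongr
      refine (add_le_add_left this _).trans (le_of_eq ?_)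
      ring
  · calc a₀ * σ * gapWeight γ q s t₀ m t ≤ a₀ * 1 * (3 * (M * (2 * (t ^ q * t ^ s / 2)))) := by
          have h1 := hb.gap_le
          have h2 : m t * (t ^ q) ^ 2 * t ^ s = M * (2 * (t ^ q * t ^ s / 2)) := by rw [hM]; ring
          rw [h2] at h1
          have h3 := hb.gap_nonneg
          gcongr
      _ ≤ a₀ * 1 * (3 * (k₁ * (2 * β))) := by
          have h1 := hb.mass_le
          have h2 := hb.le_scale
          gcongr
      _ = a₀ * (6 * k₁) * β := by ring
      _ ≤ (α - 1) / 2 * β := by gcongr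
  · calc a₀ * σ * (3 / 2 * (α - 1) ^ 2 + (α - 1))
        ≤ a₀ * (2 / c * P) * (3 / 2 * (α - 1) ^ 2 + (α - 1)) := by gcongr
      _ = a₀ * (2 / c * (3 / 2 * (α - 1) ^ 2 + (α - 1))) * P := by ring
      _ ≤ (α - 1) / 4 * P := by gcongr
      _ = _ := by ring
  · calc a₀ * σ * (3 / 2 * M) ≤ a₀ * 1 * (3 / 2 * k₁) := by
          have h1 := hb.mass_le
          gcongr
      _ ≤ 1 / 4 := by linarith
  · calc a₀ * σ * (3 / 2 * Γ) ≤ a₀ * 1 * (3 / 2 * Γ) := by gcongr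
      _ = a₀ * (3 * γ) * (t ^ q * 1 / 2) := by rw [hΓ]; ring
      _ ≤ 1 / 2 * (t ^ q * t ^ s / 2) := by gcongr
      _ ≤ 1 / 2 * β := by
        have := hb.le_scale
        gcongr
      _ = β / 2 := by ring
  · calc a₀ * σ * (1 / 2) ≤ a₀ * (2 / c * P) * (1 / 2) := by gcongr
      _ = a₀ * (1 / c) * P := by ring
      _ ≤ (α - 1) / 2 * P := by gcongr
      _ = _ := by ring
  · have h3 := norm_add_sq_le_three ha.le hM0.le hΓ0.le (x t - xt t) (tderiv t₀ x t)
      (gradPrimal f A b c p t (x t) (l t))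
    have h4 : energy f A b α γ c p q s t₀ m x l xt lt t = gapWeight γ q s t₀ m t * G
      + 1 / 2 * ‖(α - 1) • (x t - xt t) + (M • tderiv t₀ x t
        + Γ • gradPrimal f A b c p t (x t) (l t))‖ ^ 2
      + crossCoef q t₀ m t * ((α - 1) / 2) * ‖x t - xt t‖ ^ 2
      + 1 / 2 * ‖l t - lt t‖ ^ 2 := rfl
    rw [h4]
    linarith

/-- Decay of the energy along a global solution. -/
lemma exists_energy_le (hf : Differentiable ℝ f) (hconv : ConvexOn ℝ univ f)
    (hα : 1 < α) (hγ : 0 < γ) (hc : 0 < c) (hp : 0 < p) (ht₀ : 0 < t₀)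
    (hq0 : 0 < q) (hs0 : 0 < s)
    (hsol : IsGlobalSolution f A b α γ c p q s t₀ m x l)
    (hsad : ∀ t ∈ Ici t₀, IsSaddlePt (tikhonov f A b (c / t ^ p)) (xt t) (lt t))
    (hs : IsSaddlePt (lagrangian f A b) xs ls) (hk₁ : 0 < k₁)
    (hT : ∀ᶠ t in atTop, CoefBounds (α - 1) γ c p q s t₀ k₁ k₂ m t) {κ : ℝ}
    (hκ0 : 0 ≤ κ) (hκ1 : κ < 1) (hκ : p - q - s ≤ κ) :
    ∃ C, ∀ᶠ t in atTop, energy f A b α γ c p q s t₀ m x l xt lt t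
      ≤ C * (m t * t ^ (3 * q + s + p - 2 + κ)) := by
  have ha : 0 < α - 1 := by linarith
  obtain ⟨T', hT'⟩ := eventually_atTop.1 hT
  have hT : ∀ t ∈ Ici T', CoefBounds (α - 1) γ c p q s t₀ k₁ k₂ m t := fun t ht => hT' t ht
  have hT0 : 0 < T' := one_pos.trans_le (hT T' self_mem_Ici).one_le
  obtain ⟨a₀, ha₀, hn⟩ := exists_pos_mul_le
    ![6 * k₁, 2 / c * (3 / 2 * (α - 1) ^ 2 + (α - 1)), 3 / 2 * k₁, 3 * γ, 1 / c]
    ![(α - 1) / 2, (α - 1) / 4, 1 / 4, 1 / 2, (α - 1) / 2] (by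
      intro i
      fin_cases i <;> simp [ha])
  set e := 3 * q + s + p - 2 + κ
  -- For Φ = m t^e the relative decay is at most (k₂ + |e|)/t, by the bound on the derivative of the
  -- mass.
  refine exists_le_mul_of_dini (T := T') (a := a₀) (κ := κ) (k := k₂ + |e|)
    (Φ' := fun t => tderiv t₀ m t * t ^ e + m t * (e * t ^ (e - 1))) ha₀ ?_ hκ1 hT0
    (continuousOn_energy hf hconv hc hp ht₀ hsol hsad hs hT) ?_ ?_ ?_
    (fun t ht ρ hρ => eventually_slope_energy_lt hf hconv hα hγ hc hp ht₀ hq0 hs0 hsol hsad hs hT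
      ha₀ hκ0 hκ (hn 0) (hn 1) (hn 2) (hn 3) (hn 4) rfl rfl rfl ht hρ)
  · positivity
  · intro t ht
    have := (hT t ht).mass_pos
    have : 0 < t := one_pos.trans_le (hT t ht).one_le
    positivity
  · intro t ht
    have ht0 : 0 < t := one_pos.trans_le (hT t ht).one_le
    exact (hT t ht).mass_deriv.mul (Real.hasDerivAt_rpow_const (Or.inl ht0.ne'))
  · intro t ht
    have ht0 : 0 < t := one_pos.trans_le (hT t ht).one_le
    have hpow := Real.rpow_pos_of_pos ht0 e
    have hμ := (hT t ht).mass_pos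
    have h1 : -(k₂ / t * m t) ≤ tderiv t₀ m t := by
      have h2 := (hT t ht).mass_deriv_le
      have h3 : |tderiv t₀ m t| ≤ k₂ / t * m t := by
        rw [div_mul_eq_mul_div, le_div_iff₀ ht0]; linarith
      exact (abs_le.1 h3).1
    have h4 : -(|e| / t * t ^ e) ≤ e * t ^ (e - 1) := by
      rw [Real.rpow_sub_one ht0.ne']
      have : -|e| * (t ^ e / t) ≤ e * (t ^ e / t) := by
        gcongr
        exact neg_abs_le e
      refine le_trans (le_of_eq ?_) this
      ring
    have h5 := mul_le_mul_of_nonneg_right h1 hpow.le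
    have h6 := mul_le_mul_of_nonneg_left h4 hμ.le
    have h7 : (k₂ + |e|) / t * (m t * t ^ e)
        = k₂ / t * m t * t ^ e + m t * (|e| / t * t ^ e) := by ring
    rw [h7]
    linarith

end Decay

/-! ### Transfer of rates from the saddle path to the trajectory. -/

section Rates

variable {X Y : Type*} [NormedAddCommGroup X] [InnerProductSpace ℝ X] [CompleteSpace X]
  [NormedAddCommGroup Y] [InnerProductSpace ℝ Y] [CompleteSpace Y]
  {f : X → ℝ} {A : X →L[ℝ] Y} {b : Y} {c p t₀ : ℝ} {xt : ℝ → X} {lt : ℝ → Y} {xs : X} {ls : Y}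

/-- The objective residual at a regularised saddle point is at most proportional to the weight. -/
lemma abs_objective_sub_le_of_saddle (hf : Differentiable ℝ f) (hconv : ConvexOn ℝ univ f) {ε : ℝ}
    (hε : 0 < ε) {x : X} {l : Y} (h : IsSaddlePt (tikhonov f A b ε) x l)
    (hs : IsSaddlePt (lagrangian f A b) xs ls) :
    |f x - f xs| ≤ 2 * pairNorm xs ls ^ 2 * ε := by
  have hW := pairNorm_le_of_saddle hf hconv hε h hs
  set W := pairNorm xs ls
  have hx := (norm_fst_le_pairNorm x l).trans hW
  have hl := (norm_snd_le_pairNorm x l).trans hW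
  have hxs : ‖xs‖ ≤ W := norm_fst_le_pairNorm xs ls
  have hls : ‖ls‖ ≤ W := norm_snd_le_pairNorm xs ls
  have hW0 : 0 ≤ W := pairNorm_nonneg xs ls
  rw [lagrangian_eq_tikhonov] at hs
  have f1 : A x = b + ε • l := by rw [← h.feasibility]; abel
  have f2 : A xs = b := by have := hs.feasibility; rwa [zero_smul, sub_eq_zero] at this
  have e1 : gradient f x = -(ContinuousLinearMap.adjoint A l + ε • x) := by
    rw [eq_neg_iff_add_eq_zero, ← add_assoc]; exact h.gradient_eq_zero hf
  have e2 : gradient f xs = -ContinuousLinearMap.adjoint A ls := by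
    have := hs.gradient_eq_zero hf
    rwa [zero_smul, add_zero, ← eq_neg_iff_add_eq_zero] at this
  -- The gradient inequality at x gives the upper bound on f x − f xs, the one at xs the lower;
  -- optimality and feasibility make every remaining term proportional to ε.
  have g1 := gradient_le_of_convex hf hconv x xs
  have g2 := gradient_le_of_convex hf hconv xs x
  have i1 : inner ℝ (gradient f x) (xs - x) = ε * ‖l‖ ^ 2 - ε * inner ℝ x (xs - x) := by
    rw [e1, inner_neg_left, inner_add_left, ContinuousLinearMap.adjoint_inner_left, map_sub, f1, f2,
      inner_smul_left, sub_add_cancel_left, inner_neg_right, inner_smul_right,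
      real_inner_self_eq_norm_sq]
    simp
    ring
  have i2 : inner ℝ (gradient f xs) (x - xs) = -(ε * inner ℝ ls l) := by
    rw [e2, inner_neg_left, ContinuousLinearMap.adjoint_inner_left, map_sub, f1, f2,
      add_sub_cancel_left, inner_smul_right]
  rw [i1] at g1
  rw [i2] at g2
  have j1 : inner ℝ x (xs - x) ≤ 2 * W ^ 2 := by
    calc inner ℝ x (xs - x) ≤ ‖x‖ * ‖xs - x‖ := real_inner_le_norm _ _
      _ ≤ W * (W + W) := by
        have := (norm_sub_le xs x).trans (add_le_add hxs hx)
        gcongr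
      _ = _ := by ring
  have j2 : inner ℝ ls l ≤ W ^ 2 := by
    calc inner ℝ ls l ≤ ‖ls‖ * ‖l‖ := real_inner_le_norm _ _
      _ ≤ W * W := by gcongr
      _ = _ := by ring
  have k1 := mul_le_mul_of_nonneg_left j1 hε.le
  have k2 := mul_le_mul_of_nonneg_left j2 hε.le
  have k3 : 0 ≤ ε * ‖l‖ ^ 2 := by positivity
  have k4 : 0 ≤ ε * W ^ 2 := by positivity
  rw [abs_le]
  constructor <;> linarith

lemma norm_feasibility_le_of_saddle (hf : Differentiable ℝ f) (hconv : ConvexOn ℝ univ f) {ε : ℝ}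
    (hε : 0 < ε) {x : X} {l : Y} (h : IsSaddlePt (tikhonov f A b ε) x l)
    (hs : IsSaddlePt (lagrangian f A b) xs ls) : ‖A x - b‖ ≤ pairNorm xs ls * ε := by
  rw [h.feasibility, norm_smul, Real.norm_of_nonneg hε.le, mul_comm]
  gcongr
  exact (norm_snd_le_pairNorm x l).trans (pairNorm_le_of_saddle hf hconv hε h hs)

/-- The distance to the path of regularised saddle points controls all the other rates. -/
lemma tendsto_and_hasRates (hf : ContDiff ℝ 1 f) (hconv : ConvexOn ℝ univ f)
    (hc : 0 < c) (hp : 0 < p) (ht₀ : 0 < t₀)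
    (hsaddle : ∀ t ∈ Ici t₀, IsSaddlePt (regLagrangian f A b c p t) (xt t) (lt t))
    (hproj : IsMinNormSaddlePt f A b xs ls) {m : ℝ → ℝ} {x : ℝ → X} {l : ℝ → Y} {e k : ℝ}
    (he : e < 0) (hm0 : ∀ᶠ t in atTop, 0 ≤ m t) (hmk : ∀ᶠ t in atTop, m t ≤ k)
    (hd : (fun t => pairNorm (x t - xt t) (l t - lt t) ^ 2) =O[atTop] fun t => m t * t ^ (2 * e)) :
    Tendsto (fun t => pairNorm (x t - xs) (l t - ls)) atTop (𝓝 0) ∧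
      HasRates f A b p e m x l xt lt xs ls := by
  have hfd : Differentiable ℝ f := hf.differentiable one_ne_zero
  have hsad : ∀ t ∈ Ici t₀, IsSaddlePt (tikhonov f A b (c / t ^ p)) (xt t) (lt t) := fun t ht => by
    rw [← regLagrangian_eq_tikhonov]; exact hsaddle t ht
  obtain ⟨hxt, hlt⟩ := tendsto_saddle hfd hconv hc hp ht₀ hsaddle hproj
  have hpos : ∀ᶠ t : ℝ in atTop, 0 < t := eventually_gt_atTop 0
  have hmlim : Tendsto (fun t => m t * t ^ (2 * e)) atTop (𝓝 0) := by
    have h1 : Tendsto (fun t : ℝ => t ^ (2 * e)) atTop (𝓝 0) := by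
      have := tendsto_rpow_neg_atTop (show 0 < -(2 * e) by linarith)
      simpa using this
    have h2 : Tendsto (fun t : ℝ => k * t ^ (2 * e)) atTop (𝓝 0) := by simpa using h1.const_mul k
    refine squeeze_zero' ?_ ?_ h2
    · filter_upwards [hm0, hpos] with t h ht
      positivity
    · filter_upwards [hmk, hpos] with t h ht
      gcongr
  have hd0 := hd.trans_tendsto hmlim
  have hdist : Tendsto (fun t => pairNorm (x t - xt t) (l t - lt t)) atTop (𝓝 0) := by
    have := hd0.sqrt
    simpa [Real.sqrt_sq (pairNorm_nonneg _ _)] using this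
  have hxd : Tendsto (fun t => x t - xt t) atTop (𝓝 0) :=
    squeeze_zero_norm (fun t => norm_fst_le_pairNorm _ _) hdist
  have hld : Tendsto (fun t => l t - lt t) atTop (𝓝 0) :=
    squeeze_zero_norm (fun t => norm_snd_le_pairNorm _ _) hdist
  have hx : Tendsto x atTop (𝓝 xs) := by simpa using hxd.add hxt
  have hl : Tendsto l atTop (𝓝 ls) := by simpa using hld.add hlt
  have hlim : Tendsto (fun t => pairNorm (x t - xs) (l t - ls)) atTop (𝓝 0) := by
    have h1 : Tendsto (fun t => √(‖x t - xs‖ ^ 2 + ‖l t - ls‖ ^ 2)) atTop (𝓝 0) := by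
      have := (((hx.sub_const xs).norm.pow 2).add ((hl.sub_const ls).norm.pow 2)).sqrt
      simpa using this
    refine h1.congr fun t => ?_
    rw [← pairNorm_sq, Real.sqrt_sq (pairNorm_nonneg _ _)]
  have hxR : (fun t => ‖x t - xt t‖) =O[atTop] fun t => √(m t) * t ^ e := by
    obtain ⟨C, hC0, hC⟩ := hd.exists_pos
    refine IsBigO.of_bound (√C) ?_
    filter_upwards [hC.bound, hm0, hpos] with t h hm ht
    have h1 : 0 ≤ t ^ e := (Real.rpow_pos_of_pos ht e).le
    have h2 : t ^ (2 * e) = t ^ e * t ^ e := by rw [two_mul, Real.rpow_add ht]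
    rw [norm_norm, Real.norm_of_nonneg (by positivity)]
    refine (norm_fst_le_pairNorm _ (l t - lt t)).trans ?_
    rw [Real.norm_of_nonneg (by positivity), Real.norm_of_nonneg (by positivity), h2] at h
    rw [← Real.sqrt_sq (pairNorm_nonneg (x t - xt t) (l t - lt t))]
    refine (Real.sqrt_le_sqrt h).trans (le_of_eq ?_)
    rw [Real.sqrt_mul hC0.le, Real.sqrt_mul hm, Real.sqrt_mul_self h1]
  have hle1 : (fun t => √(m t) * t ^ e) =O[atTop] fun t => √(m t) * t ^ e + 1 / t ^ p := by
    refine IsBigO.of_bound 1 ?_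
    filter_upwards [hpos] with t ht
    have h1 : 0 < t ^ e := Real.rpow_pos_of_pos ht e
    have h2 : 0 < t ^ p := Real.rpow_pos_of_pos ht p
    rw [Real.norm_of_nonneg (by positivity), Real.norm_of_nonneg (by positivity), one_mul]
    exact le_add_of_nonneg_right (by positivity)
  have hle2 : (fun t : ℝ => c / t ^ p) =O[atTop] fun t => √(m t) * t ^ e + 1 / t ^ p := by
    refine IsBigO.of_bound c ?_
    filter_upwards [hpos] with t ht
    have h1 : 0 < t ^ e := Real.rpow_pos_of_pos ht e
    have h2 : 0 < t ^ p := Real.rpow_pos_of_pos ht p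
    rw [Real.norm_of_nonneg (by positivity), Real.norm_of_nonneg (by positivity)]
    have h3 : c / t ^ p = c * (1 / t ^ p) := by ring
    rw [h3]
    gcongr
    exact le_add_of_nonneg_left (by positivity)
  have hfeas : (fun t => ‖A (x t) - b‖) =O[atTop] fun t => √(m t) * t ^ e + 1 / t ^ p := by
    refine IsBigO.trans ?_ (((hxR.trans hle1).const_mul_left ‖A‖).add
      (hle2.const_mul_left (pairNorm xs ls)))
    refine IsBigO.of_bound 1 ?_
    filter_upwards [hpos, eventually_ge_atTop t₀] with t ht ht'
    have h1 := norm_feasibility_le_of_saddle hfd hconv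
      (div_pos hc (Real.rpow_pos_of_pos ht p)) (hsad t ht') hproj.1
    rw [norm_norm, one_mul]
    refine le_trans ?_ (le_abs_self _)
    have h2 : A (x t) - b = A (x t - xt t) + (A (xt t) - b) := by rw [map_sub]; abel
    rw [h2]
    exact (norm_add_le _ _).trans (add_le_add (A.le_opNorm _) h1)
  have hobj : (fun t => |f (x t) - f xs|) =O[atTop] fun t => √(m t) * t ^ e + 1 / t ^ p := by
    -- A C¹ function is Lipschitz near xs, and both x t and xt t eventually enter that
    -- neighbourhood; no global Lipschitz bound is needed.
    obtain ⟨K, U, hU, hK⟩ := hf.contDiffAt.exists_lipschitzOnWith (x := xs)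
    refine IsBigO.trans ?_ (((hxR.trans hle1).const_mul_left (K : ℝ)).add
      (hle2.const_mul_left (2 * pairNorm xs ls ^ 2)))
    refine IsBigO.of_bound 1 ?_
    filter_upwards [hpos, eventually_ge_atTop t₀, hx.eventually_mem hU, hxt.eventually_mem hU]
      with t ht ht' hxU hxtU
    have h1 := abs_objective_sub_le_of_saddle hfd hconv
      (div_pos hc (Real.rpow_pos_of_pos ht p)) (hsad t ht') hproj.1
    have h2 := hK.dist_le_mul _ hxU _ hxtU
    rw [Real.dist_eq, dist_eq_norm] at h2
    rw [Real.norm_eq_abs, abs_abs, one_mul]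
    refine le_trans ?_ (le_abs_self _)
    exact (abs_sub_le _ (f (xt t)) _).trans (add_le_add h2 h1)
  refine ⟨hlim, ⟨?_, hobj, hfeas, hd⟩⟩
  -- The gap equals the objective residual plus ⟨ls, A x − b⟩, since xs is feasible.
  refine IsBigO.trans ?_ (hobj.add (hfeas.const_mul_left ‖ls‖))
  refine IsBigO.of_bound 1 (Eventually.of_forall fun t => ?_)
  have h0 := hproj.1
  rw [lagrangian_eq_tikhonov] at h0
  have h1 : A xs - b = 0 := by rw [h0.feasibility, zero_smul]
  have h2 : lagrangian f A b (x t) ls - lagrangian f A b xs ls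
      = (f (x t) - f xs) + inner ℝ ls (A (x t) - b) := by
    simp only [lagrangian, h1, inner_zero_right]
    ring
  rw [h2, one_mul]
  refine le_trans ?_ (le_abs_self _)
  exact (norm_add_le _ _).trans (add_le_add le_rfl (norm_inner_le_norm _ _))

end Rates

end PrimalDual

theorem theorem3 {X Y : Type*}
    [NormedAddCommGroup X] [InnerProductSpace ℝ X] [CompleteSpace X]
    [NormedAddCommGroup Y] [InnerProductSpace ℝ Y] [CompleteSpace Y]
    (f : X → ℝ) (hf : ContDiff ℝ 1 f) (hconv : ConvexOn ℝ univ f)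
    (A : X →L[ℝ] Y) (b : Y)
    (α γ c p q s t₀ : ℝ) (hα : 1 < α) (hγ : 0 < γ) (hc : 0 < c)
    (hq0 : 0 < q) (hq1 : q < 1) (hs : 0 < s) (ht₀ : 0 < t₀)
    (m : ℝ → ℝ) (hm : PrimalDual.IsMass t₀ m)
    (hm1 : PrimalDual.MassBounds γ q s m) (hm2 : PrimalDual.MassDerivBounds t₀ m)
    (x : ℝ → X) (l : ℝ → Y)
    (hsol : PrimalDual.IsGlobalSolution f A b α γ c p q s t₀ m x l)
    (xt : ℝ → X) (lt : ℝ → Y)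
    (hsaddle : ∀ t ∈ Ici t₀,
      PrimalDual.IsSaddlePt (PrimalDual.regLagrangian f A b c p t) (xt t) (lt t))
    (hp1 : (1 - q) / 2 ≤ p) (hp2 : p < 1 - q)
    (hqs1 : (1 - q) / 2 ≤ 2 * q + s) (hqs2 : 2 * q + s < 1 - q)
    (hqsp : 4 * q + s + p - 2 < 0)
    (xs : X) (ls : Y) (hproj : PrimalDual.IsMinNormSaddlePt f A b xs ls) :
    Tendsto (fun t => PrimalDual.pairNorm (x t - xs) (l t - ls)) atTop (𝓝 0) ∧
    (p < 2 * q + s →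
      PrimalDual.HasRates f A b p ((4 * q + s + p - 2) / 2) m x l xt lt xs ls) ∧
    (2 * q + s ≤ p →
      PrimalDual.HasRates f A b p (q + p - 1) m x l xt lt xs ls) := by
  have hp : 0 < p := by linarith
  have hfd : Differentiable ℝ f := hf.differentiable one_ne_zero
  have hsad : ∀ t ∈ Ici t₀, PrimalDual.IsSaddlePt (PrimalDual.tikhonov f A b (c / t ^ p))
      (xt t) (lt t) := fun t ht => by
    rw [← PrimalDual.regLagrangian_eq_tikhonov]; exact hsaddle t ht
  have ha : 0 < α - 1 := by linarith
  obtain ⟨k₁, k₂, hk₁, -, hcoef⟩ := PrimalDual.eventually_coefBounds (p := p) ha hγ hc hq0 hq1 hs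
    (by linarith) hm hm1 hm2
  have hm0 : ∀ᶠ t in atTop, 0 ≤ m t := hcoef.mono fun t h => h.mass_pos.le
  have hmk : ∀ᶠ t in atTop, m t ≤ k₁ := hcoef.mono fun t h =>
    (le_mul_of_one_le_right h.mass_pos.le (Real.one_le_rpow h.one_le hq0.le)).trans h.mass_le
  have key : ∀ κ e : ℝ, 0 ≤ κ → κ < 1 → p - q - s ≤ κ → 3 * q + s + p - 2 + κ = 2 * e → e < 0 →
      Tendsto (fun t => PrimalDual.pairNorm (x t - xs) (l t - ls)) atTop (𝓝 0) ∧
        PrimalDual.HasRates f A b p e m x l xt lt xs ls := by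
    intro κ e hκ0 hκ1 hκ he he0
    refine PrimalDual.tendsto_and_hasRates hf hconv hc hp ht₀ hsaddle hproj he0 hm0 hmk ?_
    obtain ⟨C, hC⟩ := PrimalDual.exists_energy_le hfd hconv hα hγ hc hp ht₀ hq0 hs hsol hsad
      hproj.1 hk₁ hcoef hκ0 hκ1 hκ
    -- 4/(α − 1) normalises the primal coefficient (α − 1)/4 and 2 the dual coefficient 1/2; their
    -- sum covers both.
    refine IsBigO.of_bound ((4 / (α - 1) + 2) * C) ?_
    filter_upwards [hC, hcoef] with t hCt hb
    have h1 := PrimalDual.le_energy (x := x) (l := l) hα hb (hsad t hb.gt.le)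
    have ht : 0 < t := one_pos.trans_le hb.one_le
    have h2 : 0 ≤ m t * t ^ (2 * e) :=
      mul_nonneg hb.mass_pos.le (Real.rpow_pos_of_pos ht _).le
    rw [he] at hCt
    rw [Real.norm_of_nonneg (sq_nonneg _), Real.norm_of_nonneg h2, PrimalDual.pairNorm_sq, mul_assoc]
    refine le_trans ?_ (mul_le_mul_of_nonneg_left (h1.trans hCt) (by positivity))
    have h3 : (4 / (α - 1) + 2) * ((α - 1) / 4 * ‖x t - xt t‖ ^ 2 + 1 / 2 * ‖l t - lt t‖ ^ 2)
        = ‖x t - xt t‖ ^ 2 + ‖l t - lt t‖ ^ 2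
          + ((α - 1) / 2 * ‖x t - xt t‖ ^ 2 + 2 / (α - 1) * ‖l t - lt t‖ ^ 2) := by
      field_simp
      ring
    rw [h3]
    exact le_add_of_nonneg_right (by positivity)
  -- Here p − q − s < q, so κ = q is admissible and yields exponent 4q + s + p − 2. In the other
  -- case κ = p − q − s ≥ q is the smallest admissible value and yields 2q + 2p − 2.
  have h2 : p < 2 * q + s → _ := fun h => key q ((4 * q + s + p - 2) / 2) hq0.le hq1
    (by linarith) (by ring) (by linarith)
  have h3 : 2 * q + s ≤ p → _ := fun h => key (p - q - s) (q + p - 1) (by linarith) (by linarith)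
    le_rfl (by ring) (by linarith)
  refine ⟨?_, fun h => (h2 h).2, fun h => (h3 h).2⟩
  rcases lt_or_ge p (2 * q + s) with h | h
  · exact (h2 h).1
  · exact (h3 h).1
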